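/- Let $\nu_\sigma,\nu_\rho$ be Lévy measures of subordinators (measures on $(0,\infty)$ with $\int\min\{1,s\}\,\nu(ds)<\infty$), with Laplace exponents $\sigma(\eta)=\int_0^\infty(1-e^{-\eta s})\,\nu_\sigma(ds)$ and $\rho(z)=\int_0^\infty(1-e^{-zs})\,\nu_\rho(ds)$, and let $\nu_\rho\neq0$. Let $S^\sigma$ and $S^\rho$ be subordinators (Lévy processes with non-decreasing right-continuous paths) with $\mathbb{E}e^{-\eta S^\sigma(t)}=e^{-t\sigma(\eta)}$ and $\mathbb{E}e^{-\eta S^\rho(t)}=e^{-t\rho(\eta)}$ for $\eta>0$, let $L^\rho(t)=\inf\{u>0:S^\rho(u)>t\}$, suppose that $S^\sigma$ and $L^\rho$ are independent processes, and put $H(t)=S^\sigma(L^\rho(t))$, $t\ge0$. (1) For all $z>0$ and $\eta>0$, $$\int_0^\infty e^{-zt}\,\mathbb{E}e^{-\eta H(t)}\,dt=\frac{\rho(z)}{z(\sigma(\eta)+\rho(z))}.$$ (2) Suppose moreover that $\nu_\rho$ is infinite. Then $H(0)=0$ almost surely, that is, $h(x,0)\,dx=\delta_0(dx)$. If the law of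 $S^\sigma(t)$ is absolutely continuous for every $t>0$, then $H$ has a density, that is, a jointly measurable function $h\ge0$ such that $h(\cdot,t)$ is the density of $H(t)$ for $t>0$, extended by $h(x,t)=0$ for $x<0$ or $t<0$, and with $h(\cdot,0)$ on $(0,\infty)$ the density of the restriction to $(0,\infty)$ of the law of $H(0)$ (so $h(x,0)=0$ for a.e. $x>0$). Every such density $h$ solves $$\mathcal{D}_t h(x,t)=-\mathcal{D}_x h(x,t)+h(x,0)\,\bar\nu(t),\qquad \bar\nu(t)=\int_t^\infty\nu_\rho(ds),$$ where $\mathcal{D}_tf(t)=\int_0^\infty(f(t)-f(t-y))\,\nu_\rho(dy)$ and $\mathcal{D}_xf(x)=\int_0^\infty(f(x)-f(x-y))\,\nu_\sigma(dy)$, in the following senses. (a) In the sense of distributions: with $\mathcal{D}^*_t\varphi(x,t)=\int_0^\infty(\varphi(x,t)-\varphi(x,t+y))\,\nu_\rho(dy)$ and $\mathcal{D}^*_x\varphi(x,t)=\int_0^\infty(\varphi(x,t)-\varphi(x+y,t))\,\nu_\sigma(dy)$, for every $\varphi\in C_c^\infty(\mathbb{R}^2)$, $$\iint_{\mathbb{R}^2}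 h\,\mathcal{D}_t^*\varphi\,dx\,dt=-\iint_{\mathbb{R}^2} h\,\mathcal{D}_x^*\varphi\,dx\,dt+\int_0^\infty\mathbb{E}[\varphi(H(0),t)]\,\bar\nu(t)\,dt,$$ where all three integrals converge absolutely. (b) Almost everywhere: if $U\subseteq(0,\infty)^2$ is open and the functions $\int_0^\infty|h(x,t)-h(x,t-y)|\,\nu_\rho(dy)$ and $\int_0^\infty|h(x,t)-h(x-y,t)|\,\nu_\sigma(dy)$ are integrable over every compact subset of $U$, then the equation holds at almost every point $(x,t)$ of $U$. -/

import Mathlib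

open MeasureTheory ProbabilityTheory Set
open scoped NNReal ENNReal

noncomputable section

/-- A Lévy measure of a subordinator: it lives on `(0, ∞)` and `∫ min(1, s) ν(ds) < ∞`. -/
structure IsSubordinatorLevyMeasure (ν : Measure ℝ) : Prop where
  null_Iic : ν (Iic 0) = 0
  lintegral_min_lt_top : ∫⁻ s in Ioi (0 : ℝ), ENNReal.ofReal (min 1 s) ∂ν < ∞

/-- The Bernstein function `η ↦ ∫₀^∞ (1 - e^{-ηs}) ν(ds)` of the Lévy measure `ν`. -/
def laplaceExponent (ν : Measure ℝ) (η : ℝ) : ℝ :=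
  ∫ s in Ioi (0 : ℝ), (1 - Real.exp (-η * s)) ∂ν

/-- The tail `ν̄(t) = ∫_t^∞ ν(ds)` of the Lévy measure `ν`. -/
def levyTail (ν : Measure ℝ) (t : ℝ) : ℝ := ν.real (Ioi t)

/-- `S` is a (driftless) subordinator with Lévy measure `ν`: a Lévy process with almost surely
non-decreasing right-continuous paths, and with `E e^{-η S(t)} = e^{-t σ(η)}`, where `σ` is the
Laplace exponent given by `ν`. -/
structure IsSubordinator {Ω : Type*} [MeasurableSpace Ω] (P : Measure Ω)
    (S : ℝ≥0 → Ω → ℝ) (ν : Measure ℝ) : Prop where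
  measurable : ∀ t, Measurable (S t)
  zero : ∀ᵐ ω ∂P, S 0 ω = 0
  indepIncrements : HasIndepIncrements S P
  stationaryIncrements : ∀ s t : ℝ≥0, IdentDistrib (fun ω => S (s + t) ω - S s ω) (S t) P P
  monotone : ∀ᵐ ω ∂P, Monotone fun t => S t ω
  rightContinuous : ∀ᵐ ω ∂P, ∀ t, ContinuousWithinAt (fun s => S s ω) (Ioi t) t
  laplace : ∀ (t : ℝ≥0) (η : ℝ), 0 < η →
    ∫ ω, Real.exp (-η * S t ω) ∂P = Real.exp (-(t : ℝ) * laplaceExponent ν η)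

/-- The right-continuous inverse `L(t) = inf {u > 0 : T(u) > t}` of the process `T`. -/
def inverseProcess {Ω : Type*} (T : ℝ≥0 → Ω → ℝ) (t : ℝ≥0) (ω : Ω) : ℝ≥0 :=
  sInf {u : ℝ≥0 | 0 < u ∧ (t : ℝ) < T u ω}

/-- The composition `H(t) = S(L(t))`, where `L` is the inverse of `T`. -/
def composedProcess {Ω : Type*} (S T : ℝ≥0 → Ω → ℝ) (t : ℝ≥0) (ω : Ω) : ℝ :=
  S (inverseProcess T t ω) ω

/-- `h(x, t)` is a (jointly measurable) density of the non-negative process `H`, extended by zero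
to negative `x` or `t`: for `t > 0` it is the density of `H(t)`, and `h(·, 0)` is the density of
`H(0)` on `(0, ∞)`. The law of `H(0)` is allowed to have an atom at the origin, since a
process that starts at the origin has no initial density other than the Dirac delta. -/
structure IsProcessDensity {Ω : Type*} [MeasurableSpace Ω] (P : Measure Ω)
    (H : ℝ≥0 → Ω → ℝ) (h : ℝ → ℝ → ℝ) : Prop where
  measurable : Measurable (Function.uncurry h)
  nonneg : ∀ x t, 0 ≤ h x t
  eq_zero : ∀ x t, x < 0 ∨ t < 0 → h x t = 0
  density : ∀ t : ℝ≥0, 0 < t →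
    P.map (H t) = volume.withDensity fun x => ENNReal.ofReal (h x t)
  initial : (P.map (H 0)).restrict (Ioi 0) =
    (volume.restrict (Ioi 0)).withDensity fun x => ENNReal.ofReal (h x 0)

/-- The generalized fractional derivative `𝒟 f(x) = ∫₀^∞ (f(x) - f(x - y)) ν(dy)`. -/
def genDeriv (ν : Measure ℝ) (f : ℝ → ℝ) (x : ℝ) : ℝ :=
  ∫ y in Ioi (0 : ℝ), (f x - f (x - y)) ∂ν

/-- The formal adjoint `𝒟* φ(x) = ∫₀^∞ (φ(x) - φ(x + y)) ν(dy)` of `genDeriv ν`, through which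
`𝒟` acts on distributions. -/
def genDerivAdj (ν : Measure ℝ) (φ : ℝ → ℝ) (x : ℝ) : ℝ :=
  ∫ y in Ioi (0 : ℝ), (φ x - φ (x + y)) ∂ν

/-- `𝒟_t h = -𝒟_x h + h(x, 0) ν̄ρ(t)` in the sense of distributions on the plane, where `𝒟_t` and
`𝒟_x` are built from `νρ` and `νσ`, `h` is extended by zero, and `μ₀(dx)` is the initial
distribution `h(x, 0) dx`. -/
def SolvesInDistributions (νσ νρ μ₀ : Measure ℝ) (h : ℝ → ℝ → ℝ) : Prop :=
  ∀ φ : ℝ → ℝ → ℝ, ContDiff ℝ (⊤ : ℕ∞) (Function.uncurry φ) →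
    HasCompactSupport (Function.uncurry φ) →
    Integrable (fun p : ℝ × ℝ => h p.1 p.2 * genDerivAdj νρ (fun t => φ p.1 t) p.2) ∧
    Integrable (fun p : ℝ × ℝ => h p.1 p.2 * genDerivAdj νσ (fun x => φ x p.2) p.1) ∧
    IntegrableOn (fun t : ℝ => (∫ x, φ x t ∂μ₀) * levyTail νρ t) (Ioi 0) ∧
    ∫ p : ℝ × ℝ, h p.1 p.2 * genDerivAdj νρ (fun t => φ p.1 t) p.2 =
      -(∫ p : ℝ × ℝ, h p.1 p.2 * genDerivAdj νσ (fun x => φ x p.2) p.1)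
        + ∫ t in Ioi (0 : ℝ), (∫ x, φ x t ∂μ₀) * levyTail νρ t

end

/-! By independence, `E e^{-ηH(t)} = E e^{-cL(t)}` with `c = σ(η)`. Write `1 - e^{-cL(t)}` as the
integral of `c e^{-cu}` over `u < L(t)`. Up to one point, `u < L(t)` means `T(u) ≤ t`, so Tonelli
and the known transform of `T(u)` give the double Laplace transform (`laplace_composedProcess`).

For the equation, move everything to one side and regard it as a functional of the test function
(`weakDefect`). An exponential `e^{-ηx-zt}` is an eigenfunction of both adjoint operators, with
eigenvalues `ρ(z)` and `σ(η)`, so the functional vanishes on it exactly because of the Laplace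
formula (`weakDefect_exp`). To reach arbitrary test functions, put `p = e^{-x}`, `q = e^{-t}`: the
quadrant becomes the unit square and the exponentials with positive integer rates become monomials.
A test function becomes a smooth function vanishing near the axes, hence the integral over a corner
rectangle of its continuous mixed derivative `G` (`exists_eq_cornerIntegral`). The functional is
bounded by a constant times the supremum of `|G|` on the unit square (`abs_weakDefect_le`), because
the increments of a corner integral are integrals of `G` over thin rectangles. Polynomials `G` give
combinations of exponentials, so Stone–Weierstrass finishes (`weakDefect_cornerIntegral`).

The almost-everywhere form follows by testing with functions supported in `U`, moving the
differences onto `h` by Fubini and translation invariance, and applying the fundamental lemma of the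
calculus of variations (`ae_genDeriv_eq`). Densities exist because the law of `H(t)` is a mixture of
the laws of `S(u)` with `u > 0`. -/

open Filter Topology

/-! ### Lévy measures and their Laplace exponents. -/

namespace IsSubordinatorLevyMeasure

variable {ν : Measure ℝ}

theorem ae_pos (hν : IsSubordinatorLevyMeasure ν) : ∀ᵐ s ∂ν, 0 < s := by
  rw [ae_iff]
  simpa [Iic, not_lt] using hν.null_Iic

theorem restrict_eq (hν : IsSubordinatorLevyMeasure ν) : ν.restrict (Ioi 0) = ν :=
  Measure.restrict_eq_self_of_ae_mem hν.ae_pos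

/-- Weighting by `min 1 s` makes the measure finite, and the reciprocal weight, finite almost
everywhere, recovers it. This licenses every later use of Tonelli and Fubini. -/
theorem sigmaFinite (hν : IsSubordinatorLevyMeasure ν) : SigmaFinite ν := by
  set f : ℝ → ℝ≥0∞ := fun s => ENNReal.ofReal (min 1 s) with hf
  have hfm : Measurable f := by fun_prop
  have hfin : IsFiniteMeasure (ν.withDensity f) := by
    refine isFiniteMeasure_withDensity ?_
    have := hν.lintegral_min_lt_top
    rw [hν.restrict_eq] at this
    exact this.ne
  have h0 : ∀ᵐ s ∂ν, f s ≠ 0 := by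
    filter_upwards [hν.ae_pos] with s hs
    simp [hf, hs]
  rw [← withDensity_inv_same hfm h0 (ae_of_all _ fun _ => ENNReal.ofReal_ne_top)]
  refine SigmaFinite.withDensity_of_ne_top ?_
  rw [ae_withDensity_iff hfm]
  exact ae_of_all _ fun s hs => by simpa using hs

theorem integrable_min (hν : IsSubordinatorLevyMeasure ν) : Integrable (fun s => min 1 s) ν := by
  refine ⟨by fun_prop, ?_⟩
  have := hν.lintegral_min_lt_top
  rw [hν.restrict_eq] at this
  rw [hasFiniteIntegral_iff_ofReal]
  · exact this
  · filter_upwards [hν.ae_pos] with s hs using by positivity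

theorem integrable_one_sub_exp (hν : IsSubordinatorLevyMeasure ν) {η : ℝ} (hη : 0 ≤ η) :
    Integrable (fun s => 1 - Real.exp (-η * s)) ν := by
  refine (hν.integrable_min.const_mul (1 + η)).mono' (by fun_prop) ?_
  filter_upwards [hν.ae_pos] with s hs
  have h1 : Real.exp (-η * s) ≤ 1 := by
    rw [Real.exp_le_one_iff]; nlinarith
  have h2 := Real.add_one_le_exp (-η * s)
  have h3 := Real.exp_pos (-η * s)
  rw [Real.norm_of_nonneg (by linarith)]
  rcases le_total 1 s with h | h
  · rw [min_eq_left h]; nlinarith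
  · rw [min_eq_right h]; nlinarith

theorem laplaceExponent_eq (hν : IsSubordinatorLevyMeasure ν) (η : ℝ) :
    laplaceExponent ν η = ∫ s, (1 - Real.exp (-η * s)) ∂ν := by
  rw [laplaceExponent, hν.restrict_eq]

theorem one_sub_exp_nonneg (hν : IsSubordinatorLevyMeasure ν) {η : ℝ} (hη : 0 ≤ η) :
    0 ≤ᵐ[ν] fun s => 1 - Real.exp (-η * s) := by
  filter_upwards [hν.ae_pos] with s hs
  have : Real.exp (-η * s) ≤ 1 := by
    rw [Real.exp_le_one_iff]; nlinarith
  simpa using this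

theorem laplaceExponent_nonneg (hν : IsSubordinatorLevyMeasure ν) {η : ℝ} (hη : 0 ≤ η) :
    0 ≤ laplaceExponent ν η := by
  rw [hν.laplaceExponent_eq]
  exact integral_nonneg_of_ae (hν.one_sub_exp_nonneg hη)

theorem laplaceExponent_pos (hν : IsSubordinatorLevyMeasure ν) (h0 : ν ≠ 0) {η : ℝ} (hη : 0 < η) :
    0 < laplaceExponent ν η := by
  rw [hν.laplaceExponent_eq, integral_pos_iff_support_of_nonneg_ae (hν.one_sub_exp_nonneg hη.le)
    (hν.integrable_one_sub_exp hη.le)]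
  rw [pos_iff_ne_zero]
  intro h
  have h1 : ν (Ioi 0) = 0 := by
    refine measure_mono_null (fun s hs => ?_) h
    have : Real.exp (-η * s) < 1 := by
      rw [Real.exp_lt_one_iff]; nlinarith [mem_Ioi.1 hs]
    simp only [Function.mem_support]
    linarith
  apply h0
  rw [← hν.restrict_eq, Measure.restrict_eq_zero, h1]

theorem ofReal_laplaceExponent (hν : IsSubordinatorLevyMeasure ν) {η : ℝ} (hη : 0 ≤ η) :
    ENNReal.ofReal (laplaceExponent ν η) = ∫⁻ s, ENNReal.ofReal (1 - Real.exp (-η * s)) ∂ν := by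
  rw [hν.laplaceExponent_eq, ofReal_integral_eq_lintegral_ofReal (hν.integrable_one_sub_exp hη)
    (hν.one_sub_exp_nonneg hη)]

/-- Monotone convergence: `1 - e^{-ns}` increases to `1`, so the exponents increase to the total
mass. -/
theorem tendsto_laplaceExponent (hν : IsSubordinatorLevyMeasure ν) (h : ν univ = ∞) :
    Tendsto (fun n : ℕ => laplaceExponent ν n) atTop atTop := by
  rw [← ENNReal.tendsto_ofReal_nhds_top]
  have hlim : Tendsto (fun n : ℕ => ∫⁻ s, ENNReal.ofReal (1 - Real.exp (-(n : ℝ) * s)) ∂ν) atTop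
      (𝓝 (∫⁻ _, 1 ∂ν)) := by
    refine lintegral_tendsto_of_tendsto_of_monotone (fun n => by fun_prop) ?_ ?_
    · filter_upwards [hν.ae_pos] with s hs n m hnm
      refine ENNReal.ofReal_le_ofReal ?_
      have : (n : ℝ) ≤ m := by exact_mod_cast hnm
      have : Real.exp (-(m : ℝ) * s) ≤ Real.exp (-(n : ℝ) * s) := Real.exp_le_exp.2 (by nlinarith)
      linarith
    · filter_upwards [hν.ae_pos] with s hs
      rw [← ENNReal.ofReal_one]
      refine ENNReal.tendsto_ofReal ?_
      have : Tendsto (fun n : ℕ => Real.exp (-(n : ℝ) * s)) atTop (𝓝 0) := by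
        refine Real.tendsto_exp_atBot.comp ?_
        simp_rw [neg_mul]
        exact tendsto_neg_atTop_atBot.comp (tendsto_natCast_atTop_atTop.atTop_mul_const hs)
      simpa using this.const_sub 1
  rw [lintegral_one, h] at hlim
  exact hlim.congr fun n => (hν.ofReal_laplaceExponent n.cast_nonneg).symm

end IsSubordinatorLevyMeasure

/-! ### Jointly measurable versions of paths and inverses. -/

/-- The right-hand limit of a path along the grids `(k + 1) / (n + 1)`; for a right-continuous
path this is the path itself, and it is jointly measurable in time and path. -/
noncomputable def gridRightLim (f : ℝ≥0 → ℝ) (u : ℝ≥0) : ℝ :=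
  limsup (fun n : ℕ => f (((⌊((n : ℝ≥0) + 1) * u⌋₊ : ℝ≥0) + 1) / ((n : ℝ≥0) + 1))) atTop

/-- At each grid level, time enters only through an integer, so countably many coordinate
evaluations are involved. -/
theorem measurable_gridRightLim :
    Measurable fun p : ℝ≥0 × (ℝ≥0 → ℝ) => gridRightLim p.2 p.1 := by
  refine Measurable.limsup fun n => ?_
  have h1 : Measurable fun q : ℕ × (ℝ≥0 → ℝ) => q.2 (((q.1 : ℝ≥0) + 1) / ((n : ℝ≥0) + 1)) :=
    measurable_from_prod_countable_right fun k =>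
      measurable_pi_apply (((k : ℝ≥0) + 1) / ((n : ℝ≥0) + 1))
  have h2 : Measurable fun p : ℝ≥0 × (ℝ≥0 → ℝ) => (⌊((n : ℝ≥0) + 1) * p.1⌋₊, p.2) :=
    (Nat.measurable_floor.comp (by fun_prop)).prodMk measurable_snd
  exact h1.comp h2

theorem gridRightLim_eq {f : ℝ≥0 → ℝ} {u : ℝ≥0} (hf : ContinuousWithinAt f (Ioi u) u) :
    gridRightLim f u = f u := by
  refine Tendsto.limsup_eq (Tendsto.comp hf ?_)
  -- The grid point lies strictly to the right of `u`, because of the `+ 1`, and at distance at most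
  -- `1 / (n + 1)`.
  refine tendsto_nhdsWithin_iff.2 ⟨?_, Eventually.of_forall fun n => ?_⟩
  · refine tendsto_of_tendsto_of_tendsto_of_le_of_le (g := fun _ => u)
      (h := fun n : ℕ => u + 1 / ((n : ℝ≥0) + 1)) tendsto_const_nhds ?_ ?_ ?_
    · simpa using (tendsto_one_div_add_atTop_nhds_zero_nat (𝕜 := ℝ≥0)).const_add u
    · intro n
      rw [le_div_iff₀ (by positivity), mul_comm]
      exact (Nat.lt_floor_add_one _).le
    · intro n
      have h : (0 : ℝ≥0) < (n : ℝ≥0) + 1 := by positivity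
      have := Nat.floor_le (zero_le (a := ((n : ℝ≥0) + 1) * u))
      show _ ≤ _
      simp only
      rw [div_le_iff₀ h, add_mul u, one_div, inv_mul_cancel₀ h.ne', mul_comm u]
      gcongr
  · simp only [mem_Ioi]
    rw [lt_div_iff₀ (by positivity), mul_comm]
    exact Nat.lt_floor_add_one _

attribute [irreducible] gridRightLim

section Inverse

variable {Ω : Type*} {T : ℝ≥0 → Ω → ℝ} {ω : Ω}

theorem inverseProcess_le {t u : ℝ≥0} (h0 : T 0 ω = 0) (h : (t : ℝ) < T u ω) :
    inverseProcess T t ω ≤ u := by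
  refine csInf_le (OrderBot.bddBelow _) ⟨?_, h⟩
  rw [pos_iff_ne_zero]
  rintro rfl
  rw [h0] at h
  exact absurd t.coe_nonneg (not_le.2 h)

/-- Converse to `inverseProcess_le` up to the endpoint. Divergence of the path is essential: over an
empty set `sInf` would be `0` and the claim would fail. -/
theorem lt_of_inverseProcess_lt {t u : ℝ≥0} (hm : Monotone fun s => T s ω)
    (hT : Tendsto (fun s => T s ω) atTop atTop) (h : inverseProcess T t ω < u) :
    (t : ℝ) < T u ω := by
  have hne : {u : ℝ≥0 | 0 < u ∧ (t : ℝ) < T u ω}.Nonempty := by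
    obtain ⟨u, hu⟩ := ((eventually_gt_atTop 0).and (hT.eventually_gt_atTop (t : ℝ))).exists
    exact ⟨u, hu⟩
  obtain ⟨v, hv, hvu⟩ := exists_lt_of_csInf_lt hne h
  exact hv.2.trans_le (hm hvu.le)

/-- A version of the inverse process that is jointly measurable in time and chance. -/
noncomputable def ratInverse (T : ℝ≥0 → Ω → ℝ) (p : ℝ≥0 × Ω) : ℝ≥0 :=
  (⨅ q : ℚ≥0, ({p : ℝ≥0 × Ω | (p.1 : ℝ) < T q p.2}.piecewise
    (fun _ => ((q : ℝ≥0) : ℝ≥0∞)) fun _ => ∞) p).toNNReal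

theorem measurable_ratInverse [MeasurableSpace Ω] (hT : ∀ t, Measurable (T t)) :
    Measurable (ratInverse T) := by
  refine (Measurable.iInf fun q => Measurable.piecewise ?_ measurable_const
    measurable_const).ennreal_toNNReal
  exact measurableSet_lt (by fun_prop) ((hT _).comp measurable_snd)

theorem ratInverse_eq (h0 : T 0 ω = 0) (hm : Monotone fun s => T s ω)
    (hT : Tendsto (fun s => T s ω) atTop atTop) (t : ℝ≥0) :
    ratInverse T (t, ω) = inverseProcess T t ω := by
  classical
  have key : (⨅ q : ℚ≥0, ({p : ℝ≥0 × Ω | (p.1 : ℝ) < T q p.2}.piecewise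
      (fun _ => ((q : ℝ≥0) : ℝ≥0∞)) fun _ => ∞) (t, ω)) = (inverseProcess T t ω : ℝ≥0∞) := by
    refine le_antisymm (le_of_forall_gt fun x hx => ?_) (le_iInf fun q => ?_)
    · obtain ⟨y, hy, hyx⟩ := ENNReal.lt_iff_exists_nnreal_btwn.1 hx
      have hy' : inverseProcess T t ω < y := by exact_mod_cast hy
      obtain ⟨q, hq1, hq2⟩ := exists_rat_btwn (NNReal.coe_lt_coe.2 hy')
      have hq0 : 0 ≤ q := by
        have : (0 : ℝ) ≤ q := (NNReal.coe_nonneg _).trans hq1.le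
        exact_mod_cast this
      lift q to ℚ≥0 using hq0
      have e : ((q : ℚ) : ℝ) = ((q : ℝ≥0) : ℝ) := by
        simp [NNRat.cast_def]
      rw [e, NNReal.coe_lt_coe] at hq1 hq2
      refine lt_of_le_of_lt (iInf_le _ q) (lt_trans ?_ hyx)
      rw [piecewise_eq_of_mem]
      · exact_mod_cast hq2
      · exact lt_of_inverseProcess_lt hm hT hq1
    · by_cases h : (t : ℝ) < T q ω
      · rw [piecewise_eq_of_mem _ _ _ (by exact h)]
        exact_mod_cast inverseProcess_le h0 h
      · rw [piecewise_eq_of_notMem _ _ _ (by exact h)]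
        exact le_top
  rw [ratInverse, key, ENNReal.toNNReal_coe]

end Inverse

/-! ### Path properties and the law of the composed process. -/

namespace IsSubordinator

variable {Ω : Type*} [MeasurableSpace Ω] {P : Measure Ω} {T S : ℝ≥0 → Ω → ℝ} {νσ νρ ν : Measure ℝ}

theorem ae_nonneg (hS : IsSubordinator P S ν) : ∀ᵐ ω ∂P, ∀ t, 0 ≤ S t ω := by
  filter_upwards [hS.zero, hS.monotone] with ω h0 hm t
  rw [← h0]
  exact hm zero_le

theorem ae_composedProcess_nonneg (hS : IsSubordinator P S ν) (T : ℝ≥0 → Ω → ℝ) (t : ℝ≥0) :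
    ∀ᵐ ω ∂P, 0 ≤ composedProcess S T t ω := by
  filter_upwards [hS.ae_nonneg] with ω h using h _

theorem lintegral_exp (hS : IsSubordinator P S ν) [IsProbabilityMeasure P] (t : ℝ≥0) {η : ℝ}
    (hη : 0 < η) : ∫⁻ ω, ENNReal.ofReal (Real.exp (-η * S t ω)) ∂P =
      ENNReal.ofReal (Real.exp (-(t : ℝ) * laplaceExponent ν η)) := by
  have hm := hS.measurable t
  rw [← hS.laplace t η hη, ofReal_integral_eq_lintegral_ofReal]
  · refine Integrable.of_bound (C := 1) (by fun_prop) ?_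
    filter_upwards [hS.ae_nonneg] with ω h
    rw [Real.norm_of_nonneg (Real.exp_pos _).le, Real.exp_le_one_iff]
    nlinarith [h t]
  · exact ae_of_all _ fun _ => (Real.exp_pos _).le

/-- The expectation of `inf_n e^{-S(n)}` is at most `e^{-nρ(1)}` for every `n`, hence zero since
`ρ(1) > 0`. So the infimum vanishes almost surely, and monotonicity turns this into divergence. -/
theorem ae_tendsto_atTop (hS : IsSubordinator P S ν) [IsProbabilityMeasure P]
    (hν : IsSubordinatorLevyMeasure ν) (h0 : ν ≠ 0) :
    ∀ᵐ ω ∂P, Tendsto (fun t => S t ω) atTop atTop := by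
  have hρ := hν.laplaceExponent_pos h0 one_pos
  have hm : ∀ t, Measurable (S t) := hS.measurable
  have hint : ∫⁻ ω, ⨅ n : ℕ, ENNReal.ofReal (Real.exp (-1 * S n ω)) ∂P = 0 := by
    refine le_antisymm ?_ zero_le
    have hlim : Tendsto (fun n : ℕ => ENNReal.ofReal
        (Real.exp (-((n : ℝ≥0) : ℝ) * laplaceExponent ν 1))) atTop (𝓝 0) := by
      rw [← ENNReal.ofReal_zero]
      refine ENNReal.tendsto_ofReal (Real.tendsto_exp_atBot.comp ?_)
      simp_rw [neg_mul]
      exact tendsto_neg_atTop_atBot.comp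
        (by simpa using tendsto_natCast_atTop_atTop.atTop_mul_const hρ)
    refine ge_of_tendsto' hlim fun n => ?_
    rw [← hS.lintegral_exp n one_pos]
    exact lintegral_mono fun ω => iInf_le _ n
  rw [lintegral_eq_zero_iff (Measurable.iInf fun n => by fun_prop)] at hint
  filter_upwards [hint, hS.monotone] with ω h hmono
  refine tendsto_atTop_atTop_of_monotone hmono fun b => ?_
  have : ⨅ n : ℕ, ENNReal.ofReal (Real.exp (-1 * S n ω)) < ENNReal.ofReal (Real.exp (-b)) := by
    rw [h]
    simpa using Real.exp_pos _
  obtain ⟨n, hn⟩ := iInf_lt_iff.1 this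
  rw [ENNReal.ofReal_lt_ofReal_iff (Real.exp_pos _), Real.exp_lt_exp] at hn
  exact ⟨n, by linarith⟩

theorem ae_ratInverse_eq (hT : IsSubordinator P T ν) [IsProbabilityMeasure P]
    (hν : IsSubordinatorLevyMeasure ν) (h0 : ν ≠ 0) :
    ∀ᵐ ω ∂P, ∀ t, ratInverse T (t, ω) = inverseProcess T t ω := by
  filter_upwards [hT.zero, hT.monotone, hT.ae_tendsto_atTop hν h0] with ω h1 h2 h3 t
  exact ratInverse_eq h1 h2 h3 t

theorem aemeasurable_inverseProcess (hT : IsSubordinator P T ν) [IsProbabilityMeasure P]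
    (hν : IsSubordinatorLevyMeasure ν) (h0 : ν ≠ 0) (t : ℝ≥0) :
    AEMeasurable (inverseProcess T t) P := by
  refine ⟨fun ω => ratInverse T (t, ω),
    (measurable_ratInverse hT.measurable).comp measurable_prodMk_left, ?_⟩
  filter_upwards [hT.ae_ratInverse_eq hν h0] with ω h using (h t).symm

theorem ae_gridRightLim_eq (hS : IsSubordinator P S ν) :
    ∀ᵐ ω ∂P, ∀ t, gridRightLim (fun s => S s ω) t = S t ω := by
  filter_upwards [hS.rightContinuous] with ω h t using gridRightLim_eq (h t)

theorem measurable_gridRightLim (hS : IsSubordinator P S ν) :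
    Measurable fun p : ℝ≥0 × Ω => gridRightLim (fun s => S s p.2) p.1 := by
  have h : Measurable fun p : ℝ≥0 × Ω => (p.1, fun s => S s p.2) :=
    measurable_fst.prodMk
      (measurable_pi_lambda _ fun t => (hS.measurable t).comp measurable_snd)
  exact _root_.measurable_gridRightLim.comp h

/-- The composed process has a version that is jointly measurable in time and chance. -/
theorem exists_measurable_composedProcess (hS : IsSubordinator P S νσ) (hT : IsSubordinator P T νρ)
    [IsProbabilityMeasure P] (hν : IsSubordinatorLevyMeasure νρ) (h0 : νρ ≠ 0) :
    ∃ H : ℝ≥0 × Ω → ℝ, Measurable H ∧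
      ∀ᵐ ω ∂P, ∀ t, H (t, ω) = composedProcess S T t ω := by
  have h : Measurable fun p : ℝ≥0 × Ω => (ratInverse T p, p.2) :=
    (measurable_ratInverse hT.measurable).prodMk measurable_snd
  refine ⟨fun p => gridRightLim (fun s => S s p.2) (ratInverse T p),
    hS.measurable_gridRightLim.comp h, ?_⟩
  filter_upwards [hS.ae_gridRightLim_eq, hT.ae_ratInverse_eq hν h0] with ω h1 h2 t
  simp only [h1, h2, composedProcess]

theorem aemeasurable_composedProcess (hS : IsSubordinator P S νσ) (hT : IsSubordinator P T νρ)
    [IsProbabilityMeasure P] (hν : IsSubordinatorLevyMeasure νρ) (h0 : νρ ≠ 0) (t : ℝ≥0) :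
    AEMeasurable (composedProcess S T t) P := by
  obtain ⟨H, hH, hHe⟩ := hS.exists_measurable_composedProcess hT hν h0
  refine ⟨fun ω => H (t, ω), hH.comp measurable_prodMk_left, ?_⟩
  filter_upwards [hHe] with ω h using (h t).symm

/-- By independence, the law of `S (L t)` is the mixture of the laws of the `S u`. -/
theorem lintegral_composedProcess (hS : IsSubordinator P S νσ) (hT : IsSubordinator P T νρ)
    [IsProbabilityMeasure P] (hν : IsSubordinatorLevyMeasure νρ) (h0 : νρ ≠ 0)
    (hindep : IndepFun (fun ω t => S t ω) (fun ω t => inverseProcess T t ω) P) (t : ℝ≥0)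
    {g : ℝ → ℝ≥0∞} (hg : Measurable g) :
    ∫⁻ ω, g (composedProcess S T t ω) ∂P =
      ∫⁻ ω, ∫⁻ ω', g (S (inverseProcess T t ω) ω') ∂P ∂P := by
  have hX : Measurable fun ω t => S t ω := measurable_pi_lambda _ hS.measurable
  have hL := hT.aemeasurable_inverseProcess hν h0 t
  have hi : IndepFun (fun ω t => S t ω) (inverseProcess T t) P :=
    hindep.comp measurable_id (measurable_pi_apply t)
  have hmap := hi.map_prod_eq_prod_map_map hX.aemeasurable hL
  -- Evaluation of an arbitrary path at a variable time is not measurable for the product σ-algebra;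
  -- the grid limit is, and it agrees with evaluation on almost every path.
  have hΦ : Measurable fun p : (ℝ≥0 → ℝ) × ℝ≥0 => g (gridRightLim p.1 p.2) :=
    hg.comp (_root_.measurable_gridRightLim.comp measurable_swap)
  have : IsProbabilityMeasure (P.map fun ω t => S t ω) :=
    Measure.isProbabilityMeasure_map hX.aemeasurable
  have : IsProbabilityMeasure (P.map (inverseProcess T t)) :=
    Measure.isProbabilityMeasure_map hL
  calc ∫⁻ ω, g (composedProcess S T t ω) ∂P
      = ∫⁻ ω, g (gridRightLim (fun s => S s ω) (inverseProcess T t ω)) ∂P := by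
        refine lintegral_congr_ae ?_
        filter_upwards [hS.ae_gridRightLim_eq] with ω h
        rw [h, composedProcess]
    _ = ∫⁻ p, g (gridRightLim p.1 p.2)
          ∂(P.map fun ω => ((fun t => S t ω), inverseProcess T t ω)) := by
        rw [lintegral_map' hΦ.aemeasurable (hX.aemeasurable.prodMk hL)]
    _ = ∫⁻ u, ∫⁻ f, g (gridRightLim f u) ∂(P.map fun ω t => S t ω)
          ∂(P.map (inverseProcess T t)) := by
        rw [hmap, lintegral_prod_symm' _ hΦ]
    _ = ∫⁻ ω, ∫⁻ f, g (gridRightLim f (inverseProcess T t ω)) ∂(P.map fun ω t => S t ω) ∂P := by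
        rw [lintegral_map' (hΦ.lintegral_prod_left').aemeasurable hL]
    _ = _ := by
        refine lintegral_congr fun ω => ?_
        have hΦ' : Measurable fun f => g (gridRightLim f (inverseProcess T t ω)) :=
          hΦ.comp measurable_prodMk_right
        rw [lintegral_map hΦ' hX]
        refine lintegral_congr_ae ?_
        filter_upwards [hS.ae_gridRightLim_eq] with ω' h
        rw [h]

end IsSubordinator

/-! ### The double Laplace transform. -/

theorem integrableOn_exp_neg_mul {c : ℝ} (hc : 0 < c) (a : ℝ) :
    IntegrableOn (fun u => Real.exp (-c * u)) (Ioi a) :=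
  integrableOn_exp_mul_Ioi (neg_lt_zero.2 hc) a

theorem integral_exp_neg_mul {c : ℝ} (hc : 0 < c) (a : ℝ) :
    ∫ u in Ioi a, Real.exp (-c * u) = Real.exp (-c * a) / c := by
  rw [integral_exp_mul_Ioi (neg_lt_zero.2 hc), div_neg, neg_div, neg_neg]

theorem lintegral_exp_neg_mul {c : ℝ} (hc : 0 < c) (a : ℝ) :
    ∫⁻ u in Ioi a, ENNReal.ofReal (Real.exp (-c * u)) = ENNReal.ofReal (Real.exp (-c * a) / c) := by
  rw [← integral_exp_neg_mul hc,
    ofReal_integral_eq_lintegral_ofReal (integrableOn_exp_neg_mul hc a)]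
  exact ae_of_all _ fun _ => (Real.exp_pos _).le

theorem lintegral_Ioo_mul_exp_neg_mul {c ℓ : ℝ} (hc : 0 ≤ c) (hℓ : 0 ≤ ℓ) :
    ∫⁻ u in Ioo 0 ℓ, ENNReal.ofReal (c * Real.exp (-c * u)) =
      ENNReal.ofReal (1 - Real.exp (-c * ℓ)) := by
  have hcont : Continuous fun u : ℝ => c * Real.exp (-c * u) := by fun_prop
  have h : ∫ u in (0 : ℝ)..ℓ, c * Real.exp (-c * u) = 1 - Real.exp (-c * ℓ) := by
    rw [intervalIntegral.integral_eq_sub_of_hasDerivAt (f := fun u => -Real.exp (-c * u))]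
    · simp; ring
    · intro u _
      have := (((hasDerivAt_id u).const_mul (-c)).exp).neg
      simp only [id, mul_one] at this
      rw [show c * Real.exp (-c * u) = -(Real.exp (-c * u) * -c) by ring]
      exact this
    · exact hcont.intervalIntegrable _ _
  rw [← h, intervalIntegral.integral_of_le hℓ, integral_Ioc_eq_integral_Ioo,
    ofReal_integral_eq_lintegral_ofReal]
  · exact (hcont.integrableOn_Icc (a := 0) (b := ℓ)).mono_set Ioo_subset_Icc_self
  · exact ae_of_all _ fun _ => mul_nonneg hc (Real.exp_pos _).le

section Path

variable {Ω : Type*} {T : ℝ≥0 → Ω → ℝ} {ω : Ω}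

/-- Trades the inverse for the process `T`, whose Laplace transform is known: `T u ≤ t` and `u <
L(t)` agree for all `u > 0` except possibly `u = L(t)`. -/
theorem ofReal_one_sub_exp_inverseProcess (h0 : T 0 ω = 0) (hm : Monotone fun s => T s ω)
    (hT : Tendsto (fun s => T s ω) atTop atTop) {c t : ℝ} (hc : 0 ≤ c) (ht : 0 ≤ t) :
    ENNReal.ofReal (1 - Real.exp (-c * inverseProcess T t.toNNReal ω)) =
      ∫⁻ u in Ioi (0 : ℝ), {u : ℝ | T u.toNNReal ω ≤ t}.indicator
        (fun u => ENNReal.ofReal (c * Real.exp (-c * u))) u := by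
  set ℓ := inverseProcess T t.toNNReal ω with hℓ
  have hset : ∀ᵐ u : ℝ, u ∈ Ioi (0 : ℝ) → (u ∈ {u : ℝ | T u.toNNReal ω ≤ t} ↔ u ∈ Iio (ℓ : ℝ)) := by
    filter_upwards [Measure.ae_ne volume (ℓ : ℝ)] with u hu hu0
    lift u to ℝ≥0 using (mem_Ioi.1 hu0).le
    simp only [mem_Iio, Real.toNNReal_coe, NNReal.coe_lt_coe]
    constructor
    · intro h
      by_contra hlt
      have hlt' : ℓ < u := lt_of_le_of_ne (not_lt.1 hlt) fun e => hu (by rw [e])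
      have := lt_of_inverseProcess_lt hm hT hlt'
      rw [Real.coe_toNNReal _ ht] at this
      linarith
    · intro h
      by_contra hlt
      have hlt' : (t.toNNReal : ℝ) < T u ω := by
        rw [Real.coe_toNNReal _ ht]
        exact not_le.1 hlt
      exact absurd (inverseProcess_le h0 hlt') (not_le.2 h)
  rw [← lintegral_Ioo_mul_exp_neg_mul hc ℓ.coe_nonneg, ← Ioi_inter_Iio, inter_comm,
    ← Measure.restrict_restrict measurableSet_Iio, ← lintegral_indicator measurableSet_Iio]
  refine setLIntegral_congr_fun_ae measurableSet_Ioi ?_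
  filter_upwards [hset] with u hu hu0
  have hmem : u ∈ {u : ℝ | T u.toNNReal ω ≤ t} ↔ u ∈ Iio (ℓ : ℝ) := hu hu0
  by_cases h : u ∈ Iio (ℓ : ℝ)
  · rw [indicator_of_mem h, indicator_of_mem (hmem.2 h)]
  · rw [indicator_of_notMem h, indicator_of_notMem (mt hmem.1 h)]

end Path

namespace IsSubordinator

variable {Ω : Type*} [MeasurableSpace Ω] {P : Measure Ω} [IsProbabilityMeasure P]
  {S T : ℝ≥0 → Ω → ℝ} {νσ νρ : Measure ℝ}

/-- Tonelli, with `t` integrated first: the range `t ≥ T(u)` gives `e^{-zT(u)} / z`, the expectation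
gives `e^{-uρ(z)} / z`, and an exponential integral in `u` with rate `c + ρ(z)` remains. -/
theorem lintegral_one_sub_exp_inverseProcess (hT : IsSubordinator P T νρ)
    (hρ : IsSubordinatorLevyMeasure νρ) (h0 : νρ ≠ 0) {z c : ℝ} (hz : 0 < z) (hc : 0 ≤ c) :
    ∫⁻ t in Ioi (0 : ℝ), ∫⁻ ω, ENNReal.ofReal (Real.exp (-z * t)) *
        ENNReal.ofReal (1 - Real.exp (-c * inverseProcess T t.toNNReal ω)) ∂P =
      ENNReal.ofReal (c / (z * (c + laplaceExponent νρ z))) := by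
  have hρz := hρ.laplaceExponent_pos h0 hz
  have hT' : Measurable fun p : ℝ × Ω × ℝ =>
      gridRightLim (fun s => T s p.2.1) p.2.2.toNNReal :=
    hT.measurable_gridRightLim.comp
      (((measurable_snd.comp measurable_snd).real_toNNReal).prodMk
        (measurable_fst.comp measurable_snd))
  set A : Set (ℝ × Ω × ℝ) := {p | gridRightLim (fun s => T s p.2.1) p.2.2.toNNReal ≤ p.1} with hA
  have hAm : MeasurableSet A := measurableSet_le hT' measurable_fst
  set F : ℝ × Ω × ℝ → ℝ≥0∞ := A.indicator fun p =>
    ENNReal.ofReal (Real.exp (-z * p.1)) * ENNReal.ofReal (c * Real.exp (-c * p.2.2)) with hF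
  have hFm : Measurable F := Measurable.indicator (by fun_prop) hAm
  calc _ = ∫⁻ t in Ioi (0 : ℝ), ∫⁻ ω, (∫⁻ u in Ioi (0 : ℝ), F (t, ω, u)) ∂P := by
        refine setLIntegral_congr_fun measurableSet_Ioi fun t ht => ?_
        refine lintegral_congr_ae ?_
        filter_upwards [hT.zero, hT.monotone, hT.ae_tendsto_atTop hρ h0, hT.ae_gridRightLim_eq]
          with ω h1 h2 h3 h4
        rw [ofReal_one_sub_exp_inverseProcess h1 h2 h3 hc (mem_Ioi.1 ht).le,
          ← lintegral_const_mul' _ _ ENNReal.ofReal_ne_top]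
        refine lintegral_congr fun u => ?_
        simp only [hF, hA, indicator, mem_ofPred_eq, h4]
        split_ifs <;> simp
    _ = ∫⁻ t in Ioi (0 : ℝ), ∫⁻ q, F (t, q) ∂(P.prod (volume.restrict (Ioi (0 : ℝ)))) := by
        refine lintegral_congr fun t => ?_
        exact (lintegral_prod (fun q => F (t, q))
          (hFm.comp measurable_prodMk_left).aemeasurable).symm
    _ = ∫⁻ q, (∫⁻ t in Ioi (0 : ℝ), F (t, q)) ∂(P.prod (volume.restrict (Ioi (0 : ℝ)))) :=
        lintegral_lintegral_swap (f := fun t q => F (t, q)) hFm.aemeasurable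
    _ = ∫⁻ u in Ioi (0 : ℝ), ∫⁻ ω, (∫⁻ t in Ioi (0 : ℝ), F (t, ω, u)) ∂P := by
        exact lintegral_prod_symm' _ hFm.lintegral_prod_left'
    _ = ∫⁻ u in Ioi (0 : ℝ), ENNReal.ofReal (c / z) *
          ENNReal.ofReal (Real.exp (-(c + laplaceExponent νρ z) * u)) := by
        refine setLIntegral_congr_fun measurableSet_Ioi fun u hu => ?_
        have hu0 : 0 < u := hu
        have e1 : ∀ᵐ ω ∂P, ∫⁻ t in Ioi (0 : ℝ), F (t, ω, u) =
            ENNReal.ofReal (c / z * Real.exp (-c * u)) *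
              ENNReal.ofReal (Real.exp (-z * T u.toNNReal ω)) := by
          filter_upwards [hT.ae_gridRightLim_eq, hT.ae_nonneg] with ω h4 h5
          have : ∀ t, F (t, ω, u) = (Ici (T u.toNNReal ω)).indicator (fun t =>
              ENNReal.ofReal (Real.exp (-z * t)) * ENNReal.ofReal (c * Real.exp (-c * u))) t := by
            intro t
            simp only [hF, hA, indicator, mem_ofPred_eq, h4, mem_Ici]
          simp_rw [this]
          rw [lintegral_indicator measurableSet_Ici, Measure.restrict_restrict measurableSet_Ici,
            lintegral_mul_const' _ _ ENNReal.ofReal_ne_top]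
          have hae : (Ici (T u.toNNReal ω) ∩ Ioi 0 : Set ℝ) =ᵐ[volume] Ioi (T u.toNNReal ω) := by
            filter_upwards [Measure.ae_ne volume (T u.toNNReal ω)] with t ht
            refine propext ?_
            change (_ ≤ t ∧ 0 < t) ↔ _ < t
            have := h5 u.toNNReal
            constructor
            · intro h
              exact lt_of_le_of_ne h.1 (Ne.symm ht)
            · intro h
              exact ⟨h.le, this.trans_lt h⟩
          rw [Measure.restrict_congr_set hae, lintegral_exp_neg_mul hz, ← ENNReal.ofReal_mul
            (by positivity), ← ENNReal.ofReal_mul (by positivity)]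
          congr 1
          ring
        rw [lintegral_congr_ae e1, lintegral_const_mul' _ _ ENNReal.ofReal_ne_top,
          hT.lintegral_exp _ hz, Real.coe_toNNReal _ hu0.le, ← ENNReal.ofReal_mul (by positivity),
          ← ENNReal.ofReal_mul (by positivity), mul_assoc, ← Real.exp_add]
        congr 3
        ring
    _ = _ := by
        rw [lintegral_const_mul' _ _ ENNReal.ofReal_ne_top, lintegral_exp_neg_mul (by positivity),
          ← ENNReal.ofReal_mul (by positivity)]
        congr 1
        simp
        field_simp

/-- Conditioning on the inverse freezes the time, and `E e^{-ηS(u)} = e^{-uσ(η)}` is then evaluated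
at `u = L(t)`. -/
theorem integral_exp_composedProcess (hS : IsSubordinator P S νσ) (hT : IsSubordinator P T νρ)
    (hρ : IsSubordinatorLevyMeasure νρ) (h0 : νρ ≠ 0)
    (hindep : IndepFun (fun ω t => S t ω) (fun ω t => inverseProcess T t ω) P) (t : ℝ≥0)
    {η : ℝ} (hη : 0 < η) :
    ∫ ω, Real.exp (-η * composedProcess S T t ω) ∂P =
      ∫ ω, Real.exp (-laplaceExponent νσ η * ratInverse T (t, ω)) ∂P := by
  have hH := hS.aemeasurable_composedProcess hT hρ h0 t
  have hR : Measurable fun ω => ratInverse T (t, ω) :=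
    (measurable_ratInverse hT.measurable).comp measurable_prodMk_left
  rw [integral_eq_lintegral_of_nonneg_ae (ae_of_all _ fun _ => (Real.exp_pos _).le)
      (by fun_prop),
    integral_eq_lintegral_of_nonneg_ae (ae_of_all _ fun _ => (Real.exp_pos _).le)
      (by fun_prop : Measurable _).aestronglyMeasurable,
    hS.lintegral_composedProcess hT hρ h0 hindep t
      (g := fun x => ENNReal.ofReal (Real.exp (-η * x))) (by fun_prop)]
  congr 1
  refine lintegral_congr_ae ?_
  filter_upwards [hT.ae_ratInverse_eq hρ h0] with ω h
  rw [hS.lintegral_exp _ hη, h]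
  congr 2
  ring

/-- The double Laplace transform of the composed process. -/
theorem laplace_composedProcess (hS : IsSubordinator P S νσ) (hT : IsSubordinator P T νρ)
    (hσ : IsSubordinatorLevyMeasure νσ) (hρ : IsSubordinatorLevyMeasure νρ) (h0 : νρ ≠ 0)
    (hindep : IndepFun (fun ω t => S t ω) (fun ω t => inverseProcess T t ω) P)
    {z η : ℝ} (hz : 0 < z) (hη : 0 < η) :
    ∫ t in Ioi (0 : ℝ), Real.exp (-z * t) *
        (∫ ω, Real.exp (-η * composedProcess S T t.toNNReal ω) ∂P) =
      laplaceExponent νρ z / (z * (laplaceExponent νσ η + laplaceExponent νρ z)) := by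
  set c := laplaceExponent νσ η with hc_def
  have hc : 0 ≤ c := hσ.laplaceExponent_nonneg hη.le
  have hρz := hρ.laplaceExponent_pos h0 hz
  have hR : Measurable fun p : ℝ × Ω => ratInverse T (p.1.toNNReal, p.2) :=
    (measurable_ratInverse hT.measurable).comp
      (measurable_fst.real_toNNReal.prodMk measurable_snd)
  set g : ℝ × Ω → ℝ := fun p => 1 - Real.exp (-c * ratInverse T (p.1.toNNReal, p.2)) with hg
  have hgm : Measurable g := by fun_prop
  have hg0 : ∀ p, 0 ≤ g p := fun p => by
    have : Real.exp (-c * ratInverse T (p.1.toNNReal, p.2)) ≤ 1 := by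
      rw [Real.exp_le_one_iff]
      have := mul_nonneg hc (ratInverse T (p.1.toNNReal, p.2)).coe_nonneg
      linarith
    simpa [hg] using this
  have hg1 : ∀ p, g p ≤ 1 := fun p => by
    have := Real.exp_pos (-c * ratInverse T (p.1.toNNReal, p.2))
    simp only [hg]
    linarith
  have hgi : ∀ t, Integrable (fun ω => g (t, ω)) P := fun t =>
    Integrable.of_bound (C := 1) (hgm.comp measurable_prodMk_left).aestronglyMeasurable
      (ae_of_all _ fun ω => by rw [Real.norm_of_nonneg (hg0 _)]; exact hg1 _)
  have hwm : StronglyMeasurable fun t => ∫ ω, g (t, ω) ∂P :=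
    hgm.stronglyMeasurable.integral_prod_right
  have hw0 : ∀ t, 0 ≤ ∫ ω, g (t, ω) ∂P := fun t => integral_nonneg fun ω => hg0 _
  have hlin : ∫⁻ t in Ioi (0 : ℝ), ENNReal.ofReal (Real.exp (-z * t) * ∫ ω, g (t, ω) ∂P) =
      ENNReal.ofReal (c / (z * (c + laplaceExponent νρ z))) := by
    rw [← hT.lintegral_one_sub_exp_inverseProcess hρ h0 hz hc]
    refine lintegral_congr fun t => ?_
    rw [ENNReal.ofReal_mul (Real.exp_pos _).le,
      ofReal_integral_eq_lintegral_ofReal (hgi t) (ae_of_all _ fun ω => hg0 _),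
      ← lintegral_const_mul' _ _ ENNReal.ofReal_ne_top]
    refine lintegral_congr_ae ?_
    filter_upwards [hT.ae_ratInverse_eq hρ h0] with ω h
    simp only [hg, h]
  have hm : AEStronglyMeasurable (fun t => Real.exp (-z * t) * ∫ ω, g (t, ω) ∂P)
      (volume.restrict (Ioi 0)) :=
    (StronglyMeasurable.mul (by fun_prop) hwm).aestronglyMeasurable
  have hnn : 0 ≤ᵐ[volume.restrict (Ioi 0)] fun t => Real.exp (-z * t) * ∫ ω, g (t, ω) ∂P :=
    ae_of_all _ fun t => mul_nonneg (Real.exp_pos _).le (hw0 t)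
  have hint : IntegrableOn (fun t => Real.exp (-z * t) * ∫ ω, g (t, ω) ∂P) (Ioi 0) := by
    refine ⟨hm, ?_⟩
    rw [hasFiniteIntegral_iff_ofReal hnn, hlin]
    exact ENNReal.ofReal_lt_top
  have hval : ∫ t in Ioi (0 : ℝ), Real.exp (-z * t) * ∫ ω, g (t, ω) ∂P =
      c / (z * (c + laplaceExponent νρ z)) := by
    rw [integral_eq_lintegral_of_nonneg_ae hnn hm, hlin, ENNReal.toReal_ofReal (by positivity)]
  -- Passing to the complement: `1/z - c/(z(c + ρ(z))) = ρ(z)/(z(c + ρ(z)))`.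
  calc _ = ∫ t in Ioi (0 : ℝ), (Real.exp (-z * t) - Real.exp (-z * t) * ∫ ω, g (t, ω) ∂P) := by
        refine integral_congr_ae (ae_of_all _ fun t => ?_)
        simp only
        rw [hS.integral_exp_composedProcess hT hρ h0 hindep _ hη]
        have : ∫ ω, g (t, ω) ∂P =
            1 - ∫ ω, Real.exp (-c * ratInverse T (t.toNNReal, ω)) ∂P := by
          have h2 : Integrable (fun ω => Real.exp (-c * ratInverse T (t.toNNReal, ω))) P :=
            ((integrable_const (1 : ℝ)).sub (hgi t)).congr (ae_of_all _ fun ω => by simp [hg])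
          simp only [hg]
          rw [integral_sub (integrable_const _) h2]
          simp
        rw [this]
        ring
    _ = _ := by
        rw [integral_sub (integrableOn_exp_neg_mul hz 0) hint, integral_exp_neg_mul hz, hval]
        simp
        field_simp
        ring

end IsSubordinator

/-! ### Existence of a jointly measurable density. -/

/-- The densities of a Markov kernel can be chosen jointly measurable. -/
theorem ProbabilityTheory.Kernel.exists_measurable_density {α : Type*} [MeasurableSpace α]
    (κ : Kernel α ℝ) [IsMarkovKernel κ] :
    ∃ r : ℝ → α → ℝ≥0∞, Measurable (Function.uncurry r) ∧
      ∀ t, κ t ≪ volume → κ t = volume.withDensity fun x => r x t := by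
  -- The kernel is differentiated against a Gaussian, a finite measure equivalent to Lebesgue
  -- measure; multiplying by the Gaussian density converts back.
  have hm : Measurable fun p : ℝ × α => κ.rnDeriv (Kernel.const α (gaussianReal 0 1)) p.2 p.1 :=
    (Kernel.measurable_rnDeriv κ _).comp measurable_swap
  refine ⟨fun x t => gaussianPDF 0 1 x * κ.rnDeriv (Kernel.const α (gaussianReal 0 1)) t x,
    ((measurable_gaussianPDF 0 1).comp measurable_fst).mul hm, fun t ht => ?_⟩
  have hac : κ t ≪ Kernel.const α (gaussianReal 0 1) t := by
    rw [Kernel.const_apply]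
    exact ht.trans (gaussianReal_absolutelyContinuous' 0 one_ne_zero)
  conv_lhs => rw [← Kernel.withDensity_rnDeriv_eq hac]
  rw [Kernel.withDensity_apply _ (Kernel.measurable_rnDeriv κ _), Kernel.const_apply,
    gaussianReal_of_var_ne_zero 0 one_ne_zero,
    ← MeasureTheory.withDensity_mul volume (measurable_gaussianPDF 0 1)
      (Kernel.measurable_rnDeriv_right κ _ t)]
  rfl

namespace IsSubordinator

variable {Ω : Type*} [MeasurableSpace Ω] {P : Measure Ω} [IsProbabilityMeasure P]
  {S T : ℝ≥0 → Ω → ℝ} {νσ νρ : Measure ℝ}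

/-- Chernoff bound: `P(T u ≤ 0) ≤ E e^{-nT(u)} = e^{-uρ(n)}`, which tends to zero because `ρ(n)`
diverges. -/
theorem ae_pos (hT : IsSubordinator P T νρ) (hρ : IsSubordinatorLevyMeasure νρ)
    (hinf : νρ univ = ∞) {u : ℝ≥0} (hu : 0 < u) : ∀ᵐ ω ∂P, 0 < T u ω := by
  rw [ae_iff]
  refine le_antisymm ?_ zero_le
  have hlim : Tendsto (fun n : ℕ => ENNReal.ofReal
      (Real.exp (-(u : ℝ) * laplaceExponent νρ n))) atTop (𝓝 0) := by
    rw [← ENNReal.ofReal_zero]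
    refine ENNReal.tendsto_ofReal (Real.tendsto_exp_atBot.comp ?_)
    simp_rw [neg_mul]
    exact tendsto_neg_atTop_atBot.comp
      ((hρ.tendsto_laplaceExponent hinf).const_mul_atTop (NNReal.coe_pos.2 hu))
  refine ge_of_tendsto hlim ?_
  filter_upwards [eventually_gt_atTop 0] with n hn
  have hm := hT.measurable u
  rw [← hT.lintegral_exp u (Nat.cast_pos.2 hn)]
  have hle : ∀ ω, {ω | ¬ 0 < T u ω}.indicator (fun _ => (1 : ℝ≥0∞)) ω ≤
      ENNReal.ofReal (Real.exp (-(n : ℝ) * T u ω)) := by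
    intro ω
    by_cases h : ω ∈ {ω | ¬ 0 < T u ω}
    · rw [indicator_of_mem h, ENNReal.one_le_ofReal, Real.one_le_exp_iff]
      have h' : T u ω ≤ 0 := not_lt.1 h
      have : (0 : ℝ) ≤ n := n.cast_nonneg
      nlinarith
    · rw [indicator_of_notMem h]
      exact zero_le
  calc P {ω | ¬ 0 < T u ω} = ∫⁻ ω, {ω | ¬ 0 < T u ω}.indicator (fun _ => (1 : ℝ≥0∞)) ω ∂P := by
        rw [lintegral_indicator_const (by exact (measurableSet_lt measurable_const hm).compl),
          one_mul]
    _ ≤ _ := lintegral_mono hle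

/-- If `νρ` is infinite then the composed process starts at the origin. -/
theorem ae_composedProcess_zero (hS : IsSubordinator P S νσ) (hT : IsSubordinator P T νρ)
    (hρ : IsSubordinatorLevyMeasure νρ) (hinf : νρ univ = ∞) :
    ∀ᵐ ω ∂P, composedProcess S T 0 ω = 0 := by
  have hpos : ∀ᵐ ω ∂P, ∀ n : ℕ, 0 < T (1 / ((n : ℝ≥0) + 1)) ω :=
    ae_all_iff.2 fun n => hT.ae_pos hρ hinf (by positivity)
  filter_upwards [hS.zero, hT.zero, hpos] with ω h1 h2 h3
  have hL : inverseProcess T 0 ω = 0 := by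
    refine le_antisymm (ge_of_tendsto' tendsto_one_div_add_atTop_nhds_zero_nat fun n => ?_) zero_le
    exact inverseProcess_le h2 (by simpa using h3 n)
  rw [composedProcess, hL, h1]

/-- By right-continuity at the origin, `T` stays below `t` for some positive time. Hence only the
laws of `S u` with `u > 0` enter the mixture. -/
theorem ae_inverseProcess_pos (hT : IsSubordinator P T νρ) (hρ : IsSubordinatorLevyMeasure νρ)
    (h0 : νρ ≠ 0) {t : ℝ≥0} (ht : 0 < t) : ∀ᵐ ω ∂P, 0 < inverseProcess T t ω := by
  filter_upwards [hT.zero, hT.monotone, hT.ae_tendsto_atTop hρ h0, hT.rightContinuous]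
    with ω h1 h2 h3 h4
  have hlim : Tendsto (fun s => T s ω) (𝓝[>] 0) (𝓝 0) := by
    have := h4 0
    rwa [ContinuousWithinAt, h1] at this
  obtain ⟨u, hu, hu0⟩ := ((hlim.eventually_lt_const (NNReal.coe_pos.2 ht)).and
    self_mem_nhdsWithin).exists
  refine lt_of_lt_of_le (mem_Ioi.1 hu0) (not_lt.1 fun hlt => ?_)
  exact absurd (lt_of_inverseProcess_lt h2 h3 hlt) (not_lt.2 hu.le)

theorem map_composedProcess_absolutelyContinuous (hS : IsSubordinator P S νσ)
    (hT : IsSubordinator P T νρ) (hρ : IsSubordinatorLevyMeasure νρ) (h0 : νρ ≠ 0)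
    (hindep : IndepFun (fun ω t => S t ω) (fun ω t => inverseProcess T t ω) P)
    (hac : ∀ t : ℝ≥0, 0 < t → P.map (S t) ≪ volume) {t : ℝ≥0} (ht : 0 < t) :
    P.map (composedProcess S T t) ≪ volume := by
  refine Measure.AbsolutelyContinuous.mk fun A hA hA0 => ?_
  have hH := hS.aemeasurable_composedProcess hT hρ h0 t
  rw [← lintegral_indicator_one hA, lintegral_map' (by fun_prop (disch := assumption)) hH,
    hS.lintegral_composedProcess hT hρ h0 hindep t (measurable_one.indicator hA),
    lintegral_eq_zero_of_ae_eq_zero]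
  filter_upwards [hT.ae_inverseProcess_pos hρ h0 ht] with ω hω
  rw [← lintegral_map (measurable_one.indicator hA) (hS.measurable _), lintegral_indicator_one hA]
  exact hac _ hω hA0

/-- The one-dimensional laws of the composed process form a kernel. -/
theorem exists_kernel_composedProcess (hS : IsSubordinator P S νσ)
    (hT : IsSubordinator P T νρ) (hρ : IsSubordinatorLevyMeasure νρ) (h0 : νρ ≠ 0) :
    ∃ κ : Kernel ℝ≥0 ℝ, IsMarkovKernel κ ∧ ∀ t, κ t = P.map (composedProcess S T t) := by
  obtain ⟨H, hHm, hHe⟩ := hS.exists_measurable_composedProcess hT hρ h0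
  have hHt : ∀ t, Measurable fun ω => H (t, ω) := fun t => hHm.comp measurable_prodMk_left
  have hκ : Measurable fun t => P.map fun ω => H (t, ω) := by
    refine Measure.measurable_of_measurable_coe _ fun s hs => ?_
    simp_rw [Measure.map_apply (hHt _) hs]
    exact measurable_measure_prodMk_left (hHm hs)
  refine ⟨⟨fun t => P.map fun ω => H (t, ω), hκ⟩,
    ⟨fun t => Measure.isProbabilityMeasure_map (hHt t).aemeasurable⟩, fun t => ?_⟩
  refine Measure.map_congr ?_
  filter_upwards [hHe] with ω h using h t

/-- The composed process has a density if the laws of the first subordinator have densities. -/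
theorem exists_isProcessDensity (hS : IsSubordinator P S νσ)
    (hT : IsSubordinator P T νρ) (hρ : IsSubordinatorLevyMeasure νρ) (h0 : νρ ≠ 0)
    (hinf : νρ univ = ∞)
    (hindep : IndepFun (fun ω t => S t ω) (fun ω t => inverseProcess T t ω) P)
    (hac : ∀ t : ℝ≥0, 0 < t → P.map (S t) ≪ volume) :
    ∃ h : ℝ → ℝ → ℝ, IsProcessDensity P (composedProcess S T) h := by
  obtain ⟨κ, hκM, hκ⟩ := hS.exists_kernel_composedProcess hT hρ h0
  obtain ⟨r₀, hr₀m, hr₀⟩ := κ.exists_measurable_density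
  have hrm : Measurable fun p : ℝ × ℝ => r₀ p.1 p.2.toNNReal :=
    hr₀m.comp (measurable_fst.prodMk measurable_snd.real_toNNReal)
  have hr : ∀ t : ℝ≥0, 0 < t →
      P.map (composedProcess S T t) = volume.withDensity fun x => r₀ x t := fun t ht => by
    rw [← hκ]
    refine hr₀ t ?_
    rw [hκ]
    exact hS.map_composedProcess_absolutelyContinuous hT hρ h0 hindep hac ht
  have hrt : ∀ t : ℝ≥0, Measurable fun x => r₀ x t := fun t => hr₀m.comp measurable_prodMk_right
  -- Cutting off `x < 0` loses no mass as `H ≥ 0`. Cutting off `t = 0` makes the initial density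
  -- zero, which is right because `H(0) = 0` almost surely.
  let A : Set (ℝ × ℝ) := Ici 0 ×ˢ Ioi 0
  have hA : MeasurableSet A := measurableSet_Ici.prod measurableSet_Ioi
  refine ⟨fun x t => A.indicator (fun p => (r₀ p.1 p.2.toNNReal).toReal) (x, t), ?_, ?_, ?_, ?_, ?_⟩
  · exact Measurable.indicator hrm.ennreal_toReal hA
  · exact fun x t => indicator_nonneg (fun _ _ => ENNReal.toReal_nonneg) _
  · intro x t hxt
    refine indicator_of_notMem (fun hmem => ?_) _
    have h1 : 0 ≤ x ∧ 0 < t := hmem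
    rcases hxt with h | h <;> linarith
  · intro t ht
    have hH := hS.aemeasurable_composedProcess hT hρ h0 t
    rw [hr t ht]
    refine withDensity_congr_ae ?_
    have hfin : ∀ᵐ x, r₀ x t < ∞ := by
      refine ae_lt_top (hrt t) ?_
      rw [← setLIntegral_univ, ← withDensity_apply _ MeasurableSet.univ, ← hr t ht]
      have : IsProbabilityMeasure (P.map (composedProcess S T t)) :=
        Measure.isProbabilityMeasure_map hH
      exact measure_ne_top _ _
    have hneg : ∀ᵐ x, x ∈ Iio (0 : ℝ) → r₀ x t = 0 := by
      rw [← ae_restrict_iff' measurableSet_Iio]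
      refine (lintegral_eq_zero_iff (hrt t)).1 ?_
      rw [← withDensity_apply _ measurableSet_Iio, ← hr t ht,
        Measure.map_apply_of_aemeasurable hH measurableSet_Iio]
      refine measure_mono_null (fun ω hω => ?_) (ae_iff.1 (hS.ae_composedProcess_nonneg T t))
      exact not_le.2 (mem_Iio.1 hω)
    filter_upwards [hfin, hneg] with x h1 h2
    by_cases hx : 0 ≤ x
    · have hmem : (x, (t : ℝ)) ∈ A := ⟨hx, NNReal.coe_pos.2 ht⟩
      rw [indicator_of_mem hmem, Real.toNNReal_coe, ENNReal.ofReal_toReal h1.ne]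
    · have hmem : (x, (t : ℝ)) ∉ A := fun h => hx h.1
      rw [indicator_of_notMem hmem, h2 (not_le.1 hx), ENNReal.ofReal_zero]
  · have hl : (P.map (composedProcess S T 0)).restrict (Ioi 0) = 0 := by
      rw [Measure.restrict_eq_zero, Measure.map_apply_of_aemeasurable
        (hS.aemeasurable_composedProcess hT hρ h0 0) measurableSet_Ioi]
      refine measure_mono_null (fun ω hω => ?_) (ae_iff.1 (hS.ae_composedProcess_zero hT hρ hinf))
      exact (mem_Ioi.1 hω).ne'
    rw [hl]
    have hmem : ∀ x : ℝ, (x, (0 : ℝ)) ∉ A := fun x h => lt_irrefl (0 : ℝ) h.2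
    simp_rw [indicator_of_notMem (hmem _), ENNReal.ofReal_zero]
    exact withDensity_zero.symm

end IsSubordinator

/-! ### Corner integrals: the quadrant in exponential coordinates. -/

section Corner

/-- The integral of `G` over the rectangle with opposite corners `(0, 0)` and `(e⁻ˣ, e⁻ᵗ)`. -/
noncomputable def cornerIntegral (G : ℝ × ℝ → ℝ) (x t : ℝ) : ℝ :=
  ∫ w in Ioc 0 (Real.exp (-x)) ×ˢ Ioc 0 (Real.exp (-t)), G w

variable {G : ℝ × ℝ → ℝ}

theorem Continuous.integrableOn_Ioc_prod (hG : Continuous G) (a b c d : ℝ) :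
    IntegrableOn G (Ioc a b ×ˢ Ioc c d) :=
  (hG.continuousOn.integrableOn_compact (isCompact_Icc.prod isCompact_Icc)).mono_set
    (prod_mono Ioc_subset_Icc_self Ioc_subset_Icc_self)

theorem cornerIntegral_add {G' : ℝ × ℝ → ℝ} (hG : Continuous G) (hG' : Continuous G') :
    cornerIntegral (fun w => G w + G' w) =
      fun x t => cornerIntegral G x t + cornerIntegral G' x t := by
  funext x t
  exact integral_add (hG.integrableOn_Ioc_prod ..) (hG'.integrableOn_Ioc_prod ..)

theorem cornerIntegral_const_mul (c : ℝ) :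
    cornerIntegral (fun w => c * G w) = fun x t => c * cornerIntegral G x t := by
  funext x t
  exact integral_const_mul _ _

theorem measurable_cornerIntegral (hG : Continuous G) :
    Measurable (Function.uncurry (cornerIntegral G)) := by
  have hA : MeasurableSet {q : (ℝ × ℝ) × ℝ × ℝ |
      (0 < q.2.1 ∧ q.2.1 ≤ Real.exp (-q.1.1)) ∧ 0 < q.2.2 ∧ q.2.2 ≤ Real.exp (-q.1.2)} := by
    have h1 : MeasurableSet {q : (ℝ × ℝ) × ℝ × ℝ | 0 < q.2.1} :=
      measurableSet_lt (by fun_prop) (by fun_prop)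
    have h2 : MeasurableSet {q : (ℝ × ℝ) × ℝ × ℝ | q.2.1 ≤ Real.exp (-q.1.1)} :=
      measurableSet_le (by fun_prop) (by fun_prop)
    have h3 : MeasurableSet {q : (ℝ × ℝ) × ℝ × ℝ | 0 < q.2.2} :=
      measurableSet_lt (by fun_prop) (by fun_prop)
    have h4 : MeasurableSet {q : (ℝ × ℝ) × ℝ × ℝ | q.2.2 ≤ Real.exp (-q.1.2)} :=
      measurableSet_le (by fun_prop) (by fun_prop)
    exact (h1.inter h2).inter (h3.inter h4)
  have hm : Measurable fun q : (ℝ × ℝ) × ℝ × ℝ => G q.2 := hG.measurable.comp measurable_snd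
  have := (hm.indicator hA).stronglyMeasurable.integral_prod_right'
    (ν := (volume : Measure (ℝ × ℝ)))
  convert this.measurable using 1
  funext p
  rw [Function.uncurry, cornerIntegral, ← integral_indicator
    (measurableSet_Ioc.prod measurableSet_Ioc)]
  rfl

theorem volume_real_Ioc_prod {a b c d : ℝ} (hab : a ≤ b) (hcd : c ≤ d) :
    (volume : Measure (ℝ × ℝ)).real (Ioc a b ×ˢ Ioc c d) = (b - a) * (d - c) := by
  rw [Measure.volume_eq_prod, measureReal_prod_prod, Real.volume_real_Ioc_of_le hab,
    Real.volume_real_Ioc_of_le hcd]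

theorem abs_setIntegral_rectangle_le {C : ℝ}
    (hC : ∀ w ∈ (Icc 0 1 ×ˢ Icc 0 1 : Set (ℝ × ℝ)), |G w| ≤ C) {a b c d : ℝ} (ha : 0 ≤ a)
    (hab : a ≤ b) (hb : b ≤ 1) (hc : 0 ≤ c) (hcd : c ≤ d) (hd : d ≤ 1) :
    |∫ w in Ioc a b ×ˢ Ioc c d, G w| ≤ C * ((b - a) * (d - c)) := by
  rw [← volume_real_Ioc_prod hab hcd]
  refine norm_setIntegral_le_of_norm_le_const (f := G) (μ := volume) ?_ fun w hw => hC w ?_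
  · exact ((isCompact_Icc.prod isCompact_Icc).measure_lt_top).trans_le'
      (measure_mono (prod_mono Ioc_subset_Icc_self Ioc_subset_Icc_self))
  · exact ⟨⟨ha.trans hw.1.1.le, hw.1.2.trans hb⟩, ⟨hc.trans hw.2.1.le, hw.2.2.trans hd⟩⟩

/-- Bounds on `f` and its increments over the quadrant that make `f` a test function for the
generators of two subordinators. -/
structure IsQuadrantTest (f : ℝ → ℝ → ℝ) (C : ℝ) : Prop where
  measurable : Measurable (Function.uncurry f)
  abs_le : ∀ x t, 0 ≤ x → 0 ≤ t → |f x t| ≤ C * (Real.exp (-x) * Real.exp (-t))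
  abs_sub_snd_le : ∀ x t y, 0 ≤ x → 0 ≤ t → 0 ≤ y →
    |f x t - f x (t + y)| ≤ C * (Real.exp (-x) * Real.exp (-t) * (1 - Real.exp (-y)))
  abs_sub_fst_le : ∀ x t y, 0 ≤ x → 0 ≤ t → 0 ≤ y →
    |f x t - f (x + y) t| ≤ C * (Real.exp (-x) * Real.exp (-t) * (1 - Real.exp (-y)))

/-- A shift by `y` removes a rectangle of area `e^{-x} e^{-t} (1 - e^{-y})`, contained in the unit
square since `x, t ≥ 0`. The constant is thus any bound for `|G|` on that square. -/
theorem isQuadrantTest_cornerIntegral (hG : Continuous G) {C : ℝ}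
    (hC : ∀ w ∈ (Icc 0 1 ×ˢ Icc 0 1 : Set (ℝ × ℝ)), |G w| ≤ C) :
    IsQuadrantTest (cornerIntegral G) C := by
  have he1 : ∀ {x : ℝ}, 0 ≤ x → Real.exp (-x) ≤ 1 := fun hx => by
    rw [Real.exp_le_one_iff]; linarith
  have he0 : ∀ x : ℝ, 0 ≤ Real.exp (-x) := fun x => (Real.exp_pos _).le
  have hle : ∀ {x y : ℝ}, 0 ≤ y → Real.exp (-(x + y)) ≤ Real.exp (-x) := fun hy =>
    Real.exp_le_exp.2 (by linarith)
  refine ⟨measurable_cornerIntegral hG, fun x t hx ht => ?_, fun x t y hx ht hy => ?_,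
    fun x t y hx ht hy => ?_⟩
  · have := abs_setIntegral_rectangle_le hC le_rfl (he0 x) (he1 hx) le_rfl (he0 t) (he1 ht)
    rwa [sub_zero, sub_zero] at this
  · have hd : cornerIntegral G x t - cornerIntegral G x (t + y) =
        ∫ w in Ioc 0 (Real.exp (-x)) ×ˢ Ioc (Real.exp (-(t + y))) (Real.exp (-t)), G w := by
      rw [sub_eq_iff_eq_add', cornerIntegral, cornerIntegral, ← setIntegral_union,
        ← prod_union, Ioc_union_Ioc_eq_Ioc (he0 _) (hle hy)]
      · refine Set.disjoint_left.2 fun w hw hw' => ?_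
        exact absurd hw.2.2 (not_le.2 hw'.2.1)
      · exact measurableSet_Ioc.prod measurableSet_Ioc
      · exact hG.integrableOn_Ioc_prod ..
      · exact hG.integrableOn_Ioc_prod ..
    rw [hd]
    refine (abs_setIntegral_rectangle_le hC le_rfl (he0 x) (he1 hx) (he0 _) (hle hy)
      (he1 ht)).trans_eq ?_
    rw [neg_add, Real.exp_add]
    ring
  · have hd : cornerIntegral G x t - cornerIntegral G (x + y) t =
        ∫ w in Ioc (Real.exp (-(x + y))) (Real.exp (-x)) ×ˢ Ioc 0 (Real.exp (-t)), G w := by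
      rw [sub_eq_iff_eq_add', cornerIntegral, cornerIntegral, ← setIntegral_union,
        ← union_prod, Ioc_union_Ioc_eq_Ioc (he0 _) (hle hy)]
      · refine Set.disjoint_left.2 fun w hw hw' => ?_
        exact absurd hw.1.2 (not_le.2 hw'.1.1)
      · exact measurableSet_Ioc.prod measurableSet_Ioc
      · exact hG.integrableOn_Ioc_prod ..
      · exact hG.integrableOn_Ioc_prod ..
    rw [hd]
    refine (abs_setIntegral_rectangle_le hC (he0 _) (hle hy) (he1 hx) le_rfl (he0 _)
      (he1 ht)).trans_eq ?_
    rw [neg_add, Real.exp_add]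
    ring

/-- Integration raises the exponents to `j + 1` and `k + 1`, so even constant `G` yields strictly
positive rates, as the Laplace formula requires. -/
theorem cornerIntegral_monomial (j k : ℕ) :
    cornerIntegral (fun w => w.1 ^ j * w.2 ^ k) = fun x t =>
      ((j + 1 : ℝ) * (k + 1))⁻¹ * (Real.exp (-(j + 1 : ℝ) * x) * Real.exp (-(k + 1 : ℝ) * t)) := by
  funext x t
  have hpow : ∀ (n : ℕ) (y : ℝ), ∫ u in Ioc 0 (Real.exp (-y)), u ^ n =
      Real.exp (-(n + 1 : ℝ) * y) / (n + 1) := fun n y => by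
    rw [← intervalIntegral.integral_of_le (Real.exp_pos _).le, integral_pow, ← Real.exp_nat_mul]
    simp only [ne_eq, Nat.add_eq_zero_iff, one_ne_zero, and_false, not_false_eq_true, zero_pow,
      sub_zero, Nat.cast_add, Nat.cast_one]
    congr 2
    ring
  rw [cornerIntegral, Measure.volume_eq_prod,
    setIntegral_prod_mul (fun u : ℝ => u ^ j) (fun v : ℝ => v ^ k), hpow, hpow]
  field_simp

/-- Polynomials are dense among the continuous functions on the unit square. -/
theorem exists_polynomial_near (G : C(ℝ × ℝ, ℝ)) {ε : ℝ} (hε : 0 < ε) :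
    ∃ p ∈ Submodule.span ℝ {q : C(ℝ × ℝ, ℝ) | ∃ j k : ℕ, ∀ w, q w = w.1 ^ j * w.2 ^ k},
      ∀ w ∈ (Icc 0 1 ×ˢ Icc 0 1 : Set (ℝ × ℝ)), |G w - p w| ≤ ε := by
  set A : Subalgebra ℝ C(ℝ × ℝ, ℝ) :=
    Algebra.adjoin ℝ {ContinuousMap.fst, ContinuousMap.snd} with hA
  have hsep : A.SeparatesPoints := by
    intro v w hvw
    by_cases h : v.1 = w.1
    · refine ⟨_, ⟨ContinuousMap.snd, Algebra.subset_adjoin (by simp), rfl⟩, fun h' => ?_⟩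
      exact hvw (Prod.ext h h')
    · exact ⟨_, ⟨ContinuousMap.fst, Algebra.subset_adjoin (by simp), rfl⟩, h⟩
  obtain ⟨p, hp, hpG⟩ :=
    ContinuousMap.exists_mem_subalgebra_near_continuous_of_isCompact_of_separatesPoints
    hsep G (isCompact_Icc.prod isCompact_Icc) hε
  refine ⟨p, ?_, fun w hw => ?_⟩
  · have hp' : p ∈ Subalgebra.toSubmodule A := hp
    rw [hA, Algebra.adjoin_eq_span] at hp'
    refine Submodule.span_mono (fun q hq => ?_) hp'
    obtain ⟨j, k, rfl⟩ := (Submonoid.mem_closure_pair _ _ _).1 hq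
    exact ⟨j, k, fun w => rfl⟩
  · have := hpG w hw
    rw [Real.norm_eq_abs, abs_sub_comm] at this
    exact this.le

end Corner

/-! ### Test functions as corner integrals. -/

section TestFunction

/-- The pull-back of a test function under `(p, q) ↦ (-log p, -log q)`, extended by zero. -/
noncomputable def logPullback (φ : ℝ → ℝ → ℝ) (w : ℝ × ℝ) : ℝ :=
  if 0 < w.1 ∧ 0 < w.2 then φ (-Real.log w.1) (-Real.log w.2) else 0

variable {φ : ℝ → ℝ → ℝ}

theorem logPullback_exp (x t : ℝ) : logPullback φ (Real.exp (-x), Real.exp (-t)) = φ x t := by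
  simp [logPullback, Real.exp_pos]

theorem HasCompactSupport.exists_bound (hφ : HasCompactSupport (Function.uncurry φ)) :
    ∃ R, ∀ x t, R < x ∨ R < t → φ x t = 0 := by
  obtain ⟨R, hR⟩ := hφ.isCompact.isBounded.subset_closedBall 0
  refine ⟨R, fun x t h => by_contra fun hne => ?_⟩
  have hmem : (x, t) ∈ Metric.closedBall (0 : ℝ × ℝ) R := hR (subset_tsupport _ hne)
  rw [mem_closedBall_zero_iff, Prod.norm_def, max_le_iff] at hmem
  have h1 := (le_abs_self x).trans hmem.1
  have h2 := (le_abs_self t).trans hmem.2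
  rcases h with h | h <;> linarith

theorem contDiff_logPullback (hφ : ContDiff ℝ (⊤ : ℕ∞) (Function.uncurry φ))
    (hc : HasCompactSupport (Function.uncurry φ)) : ContDiff ℝ (⊤ : ℕ∞) (logPullback φ) := by
  obtain ⟨R, hR⟩ := hc.exists_bound
  have hlog : ∀ p : ℝ, 0 < p → p < Real.exp (-R) → R < -Real.log p := fun p hp hpR => by
    have := (Real.log_lt_iff_lt_exp hp).2 hpR
    linarith
  rw [contDiff_iff_contDiffAt]
  intro w
  by_cases hw : 0 < w.1 ∧ 0 < w.2
  · have hU : IsOpen {v : ℝ × ℝ | 0 < v.1 ∧ 0 < v.2} :=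
      (isOpen_lt continuous_const continuous_fst).inter (isOpen_lt continuous_const continuous_snd)
    have hev : logPullback φ =ᶠ[𝓝 w]
        fun v => Function.uncurry φ (-Real.log v.1, -Real.log v.2) := by
      filter_upwards [hU.mem_nhds hw] with v hv
      have hv' : 0 < v.1 ∧ 0 < v.2 := hv
      simp [logPullback, hv']
    refine ContDiffAt.congr_of_eventuallyEq ?_ hev
    refine hφ.contDiffAt.comp w (ContDiffAt.prodMk ?_ ?_)
    · exact (contDiffAt_fst.log hw.1.ne').neg
    · exact (contDiffAt_snd.log hw.2.ne').neg
  -- Where a coordinate is below `e^{-R}`, either the zero extension applies or its negative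
  -- logarithm exceeds `R`, beyond the support of `φ`.
  · have hU : IsOpen ({v : ℝ × ℝ | v.1 < Real.exp (-R)} ∪ {v : ℝ × ℝ | v.2 < Real.exp (-R)}) :=
      (isOpen_lt continuous_fst continuous_const).union (isOpen_lt continuous_snd continuous_const)
    have hwU : w ∈ {v : ℝ × ℝ | v.1 < Real.exp (-R)} ∪ {v : ℝ × ℝ | v.2 < Real.exp (-R)} := by
      rw [not_and_or] at hw
      rcases hw with h | h
      · exact Or.inl ((not_lt.1 h).trans_lt (Real.exp_pos _))
      · exact Or.inr ((not_lt.1 h).trans_lt (Real.exp_pos _))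
    have hev : logPullback φ =ᶠ[𝓝 w] fun _ => 0 := by
      filter_upwards [hU.mem_nhds hwU] with v hv
      rw [logPullback]
      split_ifs with h
      · rcases hv with h' | h'
        · exact hR _ _ (Or.inl (hlog _ h.1 h'))
        · exact hR _ _ (Or.inr (hlog _ h.2 h'))
      · rfl
    exact contDiffAt_const.congr_of_eventuallyEq hev

/-- A smooth function of two variables that vanishes on the axes is the integral over rectangles
of its mixed derivative. -/
theorem ContDiff.exists_integral_rectangle {F : ℝ × ℝ → ℝ} (hF : ContDiff ℝ (⊤ : ℕ∞) F)
    (h1 : ∀ v, F (0, v) = 0) (h2 : ∀ u, F (u, 0) = 0) :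
    ∃ G : ℝ × ℝ → ℝ, Continuous G ∧ ∀ a b, 0 ≤ a → 0 ≤ b →
      ∫ w in Ioc 0 a ×ˢ Ioc 0 b, G w = F (a, b) := by
  have key : ∀ {F : ℝ × ℝ → ℝ}, ContDiff ℝ (⊤ : ℕ∞) F → ∀ v : ℝ × ℝ,
      ContDiff ℝ (⊤ : ℕ∞) fun w => fderiv ℝ F w v := fun hF v =>
    (hF.fderiv_right (m := (⊤ : ℕ∞)) (by simp)).clm_apply contDiff_const
  set F₁ : ℝ × ℝ → ℝ := fun w => fderiv ℝ F w (1, 0) with hF₁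
  have hF₁c : ContDiff ℝ (⊤ : ℕ∞) F₁ := key hF _
  set G : ℝ × ℝ → ℝ := fun w => fderiv ℝ F₁ w (0, 1) with hG
  have hGc : Continuous G := (key hF₁c _).continuous
  have hd1 : ∀ u v, HasDerivAt (fun u => F (u, v)) (F₁ (u, v)) u := fun u v => by
    have h := (hF.differentiable (by simp) (u, v)).hasFDerivAt
    exact h.comp_hasDerivAt u ((hasDerivAt_id u).prodMk (hasDerivAt_const u v))
  have hd2 : ∀ u v, HasDerivAt (fun v => F₁ (u, v)) (G (u, v)) v := fun u v => by
    have h := (hF₁c.differentiable (by simp) (u, v)).hasFDerivAt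
    exact h.comp_hasDerivAt v ((hasDerivAt_const v u).prodMk (hasDerivAt_id v))
  have hF₁0 : ∀ u, F₁ (u, 0) = 0 := fun u => by
    have := hd1 u 0
    simp_rw [h2] at this
    exact this.unique (hasDerivAt_const u 0)
  refine ⟨G, hGc, fun a b ha hb => ?_⟩
  have hi : ∀ u, ∫ v in Ioc 0 b, G (u, v) = F₁ (u, b) := fun u => by
    rw [← intervalIntegral.integral_of_le hb,
      intervalIntegral.integral_eq_sub_of_hasDerivAt (fun v _ => hd2 u v)
        ((hGc.comp (by fun_prop : Continuous fun v => (u, v))).intervalIntegrable _ _),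
      hF₁0, sub_zero]
  rw [Measure.volume_eq_prod, setIntegral_prod _ (hGc.integrableOn_Ioc_prod ..)]
  simp_rw [hi]
  rw [← intervalIntegral.integral_of_le ha,
    intervalIntegral.integral_eq_sub_of_hasDerivAt (fun u _ => hd1 u b)
      ((hF₁c.continuous.comp (by fun_prop : Continuous fun u => (u, b))).intervalIntegrable _ _),
    h1, sub_zero]

/-- Every test function is a corner integral of a continuous function. -/
theorem exists_eq_cornerIntegral (hφ : ContDiff ℝ (⊤ : ℕ∞) (Function.uncurry φ))
    (hc : HasCompactSupport (Function.uncurry φ)) :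
    ∃ G : C(ℝ × ℝ, ℝ), φ = cornerIntegral G := by
  obtain ⟨G, hG, h⟩ := (contDiff_logPullback hφ hc).exists_integral_rectangle
    (fun v => by simp [logPullback]) (fun u => by simp [logPullback])
  refine ⟨⟨G, hG⟩, ?_⟩
  funext x t
  rw [← logPullback_exp (φ := φ) x t, ← h _ _ (Real.exp_pos _).le (Real.exp_pos _).le]
  rfl

end TestFunction

/-! ### The Laplace transform of the Lévy tail. -/

namespace IsSubordinatorLevyMeasure

variable {ν : Measure ℝ}

theorem measure_Ioi_lt_top (hν : IsSubordinatorLevyMeasure ν) {t : ℝ} (ht : 0 < t) :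
    ν (Ioi t) < ∞ := by
  have h : min 1 t > 0 := by positivity
  refine (measure_mono fun s (hs : t < s) => ?_).trans_lt (hν.integrable_min.measure_ge_lt_top h)
  exact min_le_min_left 1 hs.le

/-- Tonelli on the region `t < y`: the inner integral over `0 < t < y` is `(1 - e^{-zy}) / z`. -/
theorem lintegral_exp_mul_levyTail (hν : IsSubordinatorLevyMeasure ν) {z : ℝ} (hz : 0 < z) :
    ∫⁻ t in Ioi (0 : ℝ), ENNReal.ofReal (Real.exp (-z * t) * levyTail ν t) =
      ENNReal.ofReal (laplaceExponent ν z / z) := by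
  have := hν.sigmaFinite
  set A : Set (ℝ × ℝ) := {p | p.1 < p.2} with hA
  have hAm : MeasurableSet A := measurableSet_lt measurable_fst measurable_snd
  set F : ℝ × ℝ → ℝ≥0∞ := A.indicator fun p => ENNReal.ofReal (Real.exp (-z * p.1)) with hF
  have hFm : Measurable F := Measurable.indicator (by fun_prop) hAm
  calc _ = ∫⁻ t in Ioi (0 : ℝ), ∫⁻ y, F (t, y) ∂ν := by
        refine setLIntegral_congr_fun measurableSet_Ioi fun t ht => ?_
        have e : ∀ y, F (t, y) =
            (Ioi t).indicator (fun _ => ENNReal.ofReal (Real.exp (-z * t))) y := fun y => rfl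
        simp_rw [e]
        rw [lintegral_indicator_const measurableSet_Ioi, ENNReal.ofReal_mul (Real.exp_pos _).le,
          levyTail, ofReal_measureReal (hν.measure_Ioi_lt_top ht).ne]
    _ = ∫⁻ y, ∫⁻ t in Ioi (0 : ℝ), F (t, y) ∂volume ∂ν :=
        lintegral_lintegral_swap (f := fun t y => F (t, y)) hFm.aemeasurable
    _ = ∫⁻ y, ENNReal.ofReal z⁻¹ * ENNReal.ofReal (1 - Real.exp (-z * y)) ∂ν := by
        refine lintegral_congr_ae ?_
        filter_upwards [hν.ae_pos] with y hy
        have e : ∀ t, F (t, y) =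
            (Iio y).indicator (fun t => ENNReal.ofReal (Real.exp (-z * t))) t := fun y => rfl
        simp_rw [e]
        rw [lintegral_indicator measurableSet_Iio, Measure.restrict_restrict measurableSet_Iio,
          inter_comm, Ioi_inter_Iio, ← lintegral_Ioo_mul_exp_neg_mul hz.le hy.le,
          ← lintegral_const_mul' _ _ ENNReal.ofReal_ne_top]
        refine lintegral_congr fun t => ?_
        rw [← ENNReal.ofReal_mul (by positivity), inv_mul_cancel_left₀ hz.ne']
    _ = _ := by
        rw [lintegral_const_mul' _ _ ENNReal.ofReal_ne_top, ← hν.ofReal_laplaceExponent hz.le,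
          ← ENNReal.ofReal_mul (by positivity), inv_mul_eq_div]

theorem measurable_levyTail (ν : Measure ℝ) : Measurable (levyTail ν) := by
  have : Antitone fun t => ν (Ioi t) := fun s t hst => measure_mono (Ioi_subset_Ioi hst)
  exact this.measurable.ennreal_toReal

theorem integrableOn_exp_mul_levyTail (hν : IsSubordinatorLevyMeasure ν) {z : ℝ} (hz : 0 < z) :
    IntegrableOn (fun t => Real.exp (-z * t) * levyTail ν t) (Ioi 0) := by
  have := measurable_levyTail ν
  refine ⟨by fun_prop, ?_⟩
  rw [hasFiniteIntegral_iff_ofReal, hν.lintegral_exp_mul_levyTail hz]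
  · exact ENNReal.ofReal_lt_top
  · exact ae_of_all _ fun t => mul_nonneg (Real.exp_pos _).le measureReal_nonneg

theorem integral_exp_mul_levyTail (hν : IsSubordinatorLevyMeasure ν) {z : ℝ} (hz : 0 < z) :
    ∫ t in Ioi (0 : ℝ), Real.exp (-z * t) * levyTail ν t = laplaceExponent ν z / z := by
  rw [integral_eq_lintegral_of_nonneg_ae (f := fun t => Real.exp (-z * t) * levyTail ν t)
    (ae_of_all _ fun t => mul_nonneg (Real.exp_pos _).le measureReal_nonneg)
    (hν.integrableOn_exp_mul_levyTail hz).aestronglyMeasurable, hν.lintegral_exp_mul_levyTail hz,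
    ENNReal.toReal_ofReal (div_nonneg (hν.laplaceExponent_nonneg hz.le) hz.le)]

end IsSubordinatorLevyMeasure

/-! ### The weak equation from the Laplace transform. -/

/-- The measure `M` on the quadrant has the double Laplace transform of the law of the composed
process, integrated over time. -/
structure HasComposedLaplace (νσ νρ : Measure ℝ) (M : Measure (ℝ × ℝ)) : Prop where
  ae_quadrant : ∀ᵐ p ∂M, 0 ≤ p.1 ∧ 0 ≤ p.2
  integrable : ∀ z η : ℝ, 0 < z → 0 < η →
    Integrable (fun p : ℝ × ℝ => Real.exp (-η * p.1) * Real.exp (-z * p.2)) M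
  integral_eq : ∀ z η : ℝ, 0 < z → 0 < η →
    ∫ p, Real.exp (-η * p.1) * Real.exp (-z * p.2) ∂M =
      laplaceExponent νρ z / (z * (laplaceExponent νσ η + laplaceExponent νρ z))

/-- The difference of the two sides of the weak form of the governing equation. -/
noncomputable def weakDefect (νσ νρ : Measure ℝ) (M : Measure (ℝ × ℝ)) (f : ℝ → ℝ → ℝ) : ℝ :=
  ∫ q : (ℝ × ℝ) × ℝ, (f q.1.1 q.1.2 - f q.1.1 (q.1.2 + q.2)) ∂(M.prod νρ) +
    ∫ q : (ℝ × ℝ) × ℝ, (f q.1.1 q.1.2 - f (q.1.1 + q.2) q.1.2) ∂(M.prod νσ) -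
    ∫ t in Ioi (0 : ℝ), f 0 t * levyTail νρ t

namespace IsQuadrantTest

variable {f : ℝ → ℝ → ℝ} {C : ℝ} {νσ νρ : Measure ℝ}

theorem measurable_sub_snd (hf : IsQuadrantTest f C) :
    Measurable fun q : (ℝ × ℝ) × ℝ => f q.1.1 q.1.2 - f q.1.1 (q.1.2 + q.2) := by
  have h1 : Measurable fun q : (ℝ × ℝ) × ℝ => f q.1.1 q.1.2 := hf.measurable.comp measurable_fst
  have h2 : Measurable fun q : (ℝ × ℝ) × ℝ => f q.1.1 (q.1.2 + q.2) :=
    hf.measurable.comp (by fun_prop : Measurable fun q : (ℝ × ℝ) × ℝ => (q.1.1, q.1.2 + q.2))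
  exact h1.sub h2

theorem measurable_sub_fst (hf : IsQuadrantTest f C) :
    Measurable fun q : (ℝ × ℝ) × ℝ => f q.1.1 q.1.2 - f (q.1.1 + q.2) q.1.2 := by
  have h1 : Measurable fun q : (ℝ × ℝ) × ℝ => f q.1.1 q.1.2 := hf.measurable.comp measurable_fst
  have h2 : Measurable fun q : (ℝ × ℝ) × ℝ => f (q.1.1 + q.2) q.1.2 :=
    hf.measurable.comp (by fun_prop : Measurable fun q : (ℝ × ℝ) × ℝ => (q.1.1 + q.2, q.1.2))
  exact h1.sub h2

theorem abs_initial_le (hf : IsQuadrantTest f C) : ∀ t ∈ Ioi (0 : ℝ),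
    ‖f 0 t * levyTail νρ t‖ ≤ C * (Real.exp (-1 * t) * levyTail νρ t) := fun t ht => by
  have := hf.abs_le 0 t le_rfl (mem_Ioi.1 ht).le
  rw [neg_zero, Real.exp_zero, one_mul] at this
  have h0 : 0 ≤ levyTail νρ t := measureReal_nonneg
  rw [neg_one_mul, ← mul_assoc, norm_mul, Real.norm_eq_abs, Real.norm_of_nonneg h0]
  exact mul_le_mul_of_nonneg_right this h0

theorem integrableOn_initial (hf : IsQuadrantTest f C) (hρ : IsSubordinatorLevyMeasure νρ) :
    IntegrableOn (fun t => f 0 t * levyTail νρ t) (Ioi 0) := by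
  have h1 : Measurable fun t => f 0 t := hf.measurable.comp measurable_prodMk_left
  have h2 := IsSubordinatorLevyMeasure.measurable_levyTail νρ
  exact ((hρ.integrableOn_exp_mul_levyTail one_pos).const_mul C).mono' (by fun_prop)
    ((ae_restrict_iff' measurableSet_Ioi).2 (ae_of_all _ hf.abs_initial_le))

theorem abs_integral_initial_le (hf : IsQuadrantTest f C) (hρ : IsSubordinatorLevyMeasure νρ) :
    |∫ t in Ioi (0 : ℝ), f 0 t * levyTail νρ t| ≤ C * laplaceExponent νρ 1 := by
  refine (norm_integral_le_of_norm_le ((hρ.integrableOn_exp_mul_levyTail one_pos).const_mul C)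
    ((ae_restrict_iff' measurableSet_Ioi).2 (ae_of_all _ hf.abs_initial_le))).trans_eq ?_
  rw [integral_const_mul, hρ.integral_exp_mul_levyTail one_pos, div_one]

end IsQuadrantTest

namespace HasComposedLaplace

variable {νσ νρ ν : Measure ℝ} {M : Measure (ℝ × ℝ)} {f : ℝ → ℝ → ℝ} {C : ℝ}

section Bound

variable {g : (ℝ × ℝ) × ℝ → ℝ}

theorem ae_norm_le (hM : HasComposedLaplace νσ νρ M) [SFinite M]
    (hν : IsSubordinatorLevyMeasure ν)
    (hg : ∀ x t y, 0 ≤ x → 0 ≤ t → 0 ≤ y →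
      |g ((x, t), y)| ≤ C * (Real.exp (-x) * Real.exp (-t) * (1 - Real.exp (-y)))) :
    ∀ᵐ q ∂(M.prod ν), ‖g q‖ ≤
      C * ((Real.exp (-1 * q.1.1) * Real.exp (-1 * q.1.2)) * (1 - Real.exp (-1 * q.2))) := by
  have := hν.sigmaFinite
  filter_upwards [Measure.quasiMeasurePreserving_fst.ae hM.ae_quadrant,
    Measure.quasiMeasurePreserving_snd.ae hν.ae_pos] with q h1 h2
  simp_rw [neg_one_mul]
  exact hg _ _ _ h1.1 h1.2 h2.le

/-- The dominating function is a product: one factor is integrable by the Laplace hypothesis at `z =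
η = 1`, the other by the Lévy condition. -/
theorem integrable_bound (hM : HasComposedLaplace νσ νρ M) [SFinite M]
    (hν : IsSubordinatorLevyMeasure ν) (C : ℝ) :
    Integrable (fun q : (ℝ × ℝ) × ℝ => C * ((Real.exp (-1 * q.1.1) * Real.exp (-1 * q.1.2)) *
      (1 - Real.exp (-1 * q.2)))) (M.prod ν) := by
  have := hν.sigmaFinite
  exact ((hM.integrable 1 1 one_pos one_pos).mul_prod
    (hν.integrable_one_sub_exp zero_le_one)).const_mul C

theorem integrable_prod (hM : HasComposedLaplace νσ νρ M) [SFinite M]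
    (hν : IsSubordinatorLevyMeasure ν) (hgm : Measurable g)
    (hg : ∀ x t y, 0 ≤ x → 0 ≤ t → 0 ≤ y →
      |g ((x, t), y)| ≤ C * (Real.exp (-x) * Real.exp (-t) * (1 - Real.exp (-y)))) :
    Integrable g (M.prod ν) :=
  (hM.integrable_bound hν C).mono' hgm.aestronglyMeasurable (hM.ae_norm_le hν hg)

theorem abs_integral_prod_le (hM : HasComposedLaplace νσ νρ M) [SFinite M]
    (hν : IsSubordinatorLevyMeasure ν)
    (hg : ∀ x t y, 0 ≤ x → 0 ≤ t → 0 ≤ y →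
      |g ((x, t), y)| ≤ C * (Real.exp (-x) * Real.exp (-t) * (1 - Real.exp (-y)))) :
    |∫ q, g q ∂(M.prod ν)| ≤ C * ((∫ p, Real.exp (-1 * p.1) * Real.exp (-1 * p.2) ∂M) *
      laplaceExponent ν 1) := by
  have := hν.sigmaFinite
  refine (norm_integral_le_of_norm_le (hM.integrable_bound hν C) (hM.ae_norm_le hν hg)).trans_eq ?_
  rw [integral_const_mul, hν.laplaceExponent_eq,
    integral_prod_mul (fun p : ℝ × ℝ => Real.exp (-1 * p.1) * Real.exp (-1 * p.2))
      fun y => 1 - Real.exp (-1 * y)]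

end Bound

theorem weakDefect_add (hM : HasComposedLaplace νσ νρ M) [SFinite M]
    (hσ : IsSubordinatorLevyMeasure νσ) (hρ : IsSubordinatorLevyMeasure νρ)
    {f' : ℝ → ℝ → ℝ} {C' : ℝ} (hf : IsQuadrantTest f C) (hf' : IsQuadrantTest f' C') :
    weakDefect νσ νρ M (fun x t => f x t + f' x t) =
      weakDefect νσ νρ M f + weakDefect νσ νρ M f' := by
  have e1 := integral_add (hM.integrable_prod hρ hf.measurable_sub_snd hf.abs_sub_snd_le)
    (hM.integrable_prod hρ hf'.measurable_sub_snd hf'.abs_sub_snd_le)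
  have e2 := integral_add (hM.integrable_prod hσ hf.measurable_sub_fst hf.abs_sub_fst_le)
    (hM.integrable_prod hσ hf'.measurable_sub_fst hf'.abs_sub_fst_le)
  have e3 := integral_add (hf.integrableOn_initial hρ) (hf'.integrableOn_initial hρ)
  simp only [weakDefect, add_mul, add_sub_add_comm (f _ _), e1, e2, e3]
  ring

theorem weakDefect_const_mul (c : ℝ) :
    weakDefect νσ νρ M (fun x t => c * f x t) = c * weakDefect νσ νρ M f := by
  simp only [weakDefect, ← mul_sub, mul_assoc, integral_const_mul]
  ring

/-- Apart from `C` the bound does not depend on `f`. For corner integrals this is continuity in the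
supremum norm of `G`, which permits polynomial approximation. -/
theorem abs_weakDefect_le (hM : HasComposedLaplace νσ νρ M) [SFinite M]
    (hσ : IsSubordinatorLevyMeasure νσ) (hρ : IsSubordinatorLevyMeasure νρ)
    (hf : IsQuadrantTest f C) :
    |weakDefect νσ νρ M f| ≤ C * ((∫ p, Real.exp (-1 * p.1) * Real.exp (-1 * p.2) ∂M) *
      (laplaceExponent νρ 1 + laplaceExponent νσ 1) + laplaceExponent νρ 1) := by
  have e1 := hM.abs_integral_prod_le hρ
    (g := fun q => f q.1.1 q.1.2 - f q.1.1 (q.1.2 + q.2)) hf.abs_sub_snd_le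
  have e2 := hM.abs_integral_prod_le hσ
    (g := fun q => f q.1.1 q.1.2 - f (q.1.1 + q.2) q.1.2) hf.abs_sub_fst_le
  have e3 := hf.abs_integral_initial_le hρ
  refine (abs_sub _ _).trans ((add_le_add ((abs_add_le _ _).trans (add_le_add e1 e2))
    e3).trans_eq ?_)
  ring

/-- The two difference terms multiply the transform of `M` by `ρ(z)` and `σ(η)`, and the tail term
is `ρ(z)/z`; these cancel by the formula for the transform. -/
theorem weakDefect_exp (hM : HasComposedLaplace νσ νρ M) [SFinite M]
    (hσ : IsSubordinatorLevyMeasure νσ) (hρ : IsSubordinatorLevyMeasure νρ) (h0 : νρ ≠ 0)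
    {z η : ℝ} (hz : 0 < z) (hη : 0 < η) :
    weakDefect νσ νρ M (fun x t => Real.exp (-η * x) * Real.exp (-z * t)) = 0 := by
  have := hρ.sigmaFinite
  have := hσ.sigmaFinite
  have hρz := hρ.laplaceExponent_pos h0 hz
  have hση := hσ.laplaceExponent_nonneg hη.le
  have e1 : ∀ q : (ℝ × ℝ) × ℝ, Real.exp (-η * q.1.1) * Real.exp (-z * q.1.2) -
      Real.exp (-η * q.1.1) * Real.exp (-z * (q.1.2 + q.2)) =
      (Real.exp (-η * q.1.1) * Real.exp (-z * q.1.2)) * (1 - Real.exp (-z * q.2)) := fun q => by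
    rw [mul_add, Real.exp_add]; ring
  have e2 : ∀ q : (ℝ × ℝ) × ℝ, Real.exp (-η * q.1.1) * Real.exp (-z * q.1.2) -
      Real.exp (-η * (q.1.1 + q.2)) * Real.exp (-z * q.1.2) =
      (Real.exp (-η * q.1.1) * Real.exp (-z * q.1.2)) * (1 - Real.exp (-η * q.2)) := fun q => by
    rw [mul_add, Real.exp_add]; ring
  simp only [weakDefect, e1, e2, mul_zero, Real.exp_zero, one_mul]
  rw [integral_prod_mul (fun p : ℝ × ℝ => Real.exp (-η * p.1) * Real.exp (-z * p.2))
      fun y => 1 - Real.exp (-z * y),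
    integral_prod_mul (fun p : ℝ × ℝ => Real.exp (-η * p.1) * Real.exp (-z * p.2))
      fun y => 1 - Real.exp (-η * y), ← hρ.laplaceExponent_eq, ← hσ.laplaceExponent_eq,
    hρ.integral_exp_mul_levyTail hz, hM.integral_eq z η hz hη]
  field_simp
  ring

theorem _root_.ContinuousMap.exists_isQuadrantTest (G : C(ℝ × ℝ, ℝ)) :
    ∃ C, IsQuadrantTest (cornerIntegral G) C := by
  obtain ⟨C, hC⟩ := (isCompact_Icc.prod isCompact_Icc :
    IsCompact (Icc 0 1 ×ˢ Icc 0 1 : Set (ℝ × ℝ))).exists_bound_of_continuousOn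
    G.continuous.continuousOn
  exact ⟨C, isQuadrantTest_cornerIntegral G.continuous hC⟩

/-- The weak form of the governing equation for corner integrals. -/
theorem weakDefect_cornerIntegral (hM : HasComposedLaplace νσ νρ M) [SFinite M]
    (hσ : IsSubordinatorLevyMeasure νσ) (hρ : IsSubordinatorLevyMeasure νρ) (h0 : νρ ≠ 0)
    (G : C(ℝ × ℝ, ℝ)) : weakDefect νσ νρ M (cornerIntegral G) = 0 := by
  have hadd : ∀ p q : C(ℝ × ℝ, ℝ), weakDefect νσ νρ M (cornerIntegral fun w => p w + q w) =
      weakDefect νσ νρ M (cornerIntegral p) + weakDefect νσ νρ M (cornerIntegral q) := by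
    intro p q
    obtain ⟨_, hp⟩ := p.exists_isQuadrantTest
    obtain ⟨_, hq⟩ := q.exists_isQuadrantTest
    rw [cornerIntegral_add p.continuous q.continuous, hM.weakDefect_add hσ hρ hp hq]
  have hpoly : ∀ p ∈ Submodule.span ℝ
      {q : C(ℝ × ℝ, ℝ) | ∃ j k : ℕ, ∀ w, q w = w.1 ^ j * w.2 ^ k},
      weakDefect νσ νρ M (cornerIntegral p) = 0 := by
    intro p hp
    induction hp using Submodule.span_induction with
    | mem q hq =>
      obtain ⟨j, k, hjk⟩ := hq
      have : (q : ℝ × ℝ → ℝ) = fun w => w.1 ^ j * w.2 ^ k := funext hjk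
      rw [this, cornerIntegral_monomial, weakDefect_const_mul,
        hM.weakDefect_exp hσ hρ h0 (by positivity) (by positivity), mul_zero]
    | zero =>
      have := hadd 0 0
      simp only [ContinuousMap.zero_apply, add_zero] at this
      exact left_eq_add.1 this
    | add p q _ _ hp hq =>
      have := hadd p q
      rw [hp, hq, add_zero] at this
      exact this
    | smul c p _ hp =>
      have : ((c • p : C(ℝ × ℝ, ℝ)) : ℝ × ℝ → ℝ) = fun w => c * p w := rfl
      rw [this, cornerIntegral_const_mul, weakDefect_const_mul, hp, mul_zero]
  set K := (∫ p, Real.exp (-1 * p.1) * Real.exp (-1 * p.2) ∂M) *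
      (laplaceExponent νρ 1 + laplaceExponent νσ 1) + laplaceExponent νρ 1 with hK
  have hbound : ∀ ε > 0, |weakDefect νσ νρ M (cornerIntegral G)| ≤ ε * K := by
    intro ε hε
    obtain ⟨p, hp, hpG⟩ := exists_polynomial_near G hε
    -- The polynomial part contributes nothing, and the remainder is at most `ε` on the unit square.
    have hd := hadd p (G - p)
    simp only [ContinuousMap.sub_apply, add_sub_cancel] at hd
    rw [hd, hpoly p hp, zero_add]
    exact hM.abs_weakDefect_le hσ hρ (isQuadrantTest_cornerIntegral (G - p).continuous hpG)
  have hlim : Tendsto (fun ε : ℝ => ε * K) (𝓝[>] 0) (𝓝 0) := by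
    have : Tendsto (fun ε : ℝ => ε * K) (𝓝 0) (𝓝 (0 * K)) := tendsto_id.mul_const K
    rw [zero_mul] at this
    exact this.mono_left nhdsWithin_le_nhds
  exact abs_nonpos_iff.1 (ge_of_tendsto hlim (eventually_mem_nhdsWithin.mono hbound))

end HasComposedLaplace

/-! ### Densities as distributional solutions. -/

namespace IsProcessDensity

variable {Ω : Type*} [MeasurableSpace Ω] {P : Measure Ω}
  {H : ℝ≥0 → Ω → ℝ} {h : ℝ → ℝ → ℝ} {νσ νρ : Measure ℝ}

theorem lintegral_exp_planar [IsProbabilityMeasure P] (hd : IsProcessDensity P H h)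
    (hHm : ∀ t, AEMeasurable (H t) P)
    (hH0 : ∀ t, ∀ᵐ ω ∂P, 0 ≤ H t ω) {z η : ℝ} (hη : 0 < η) :
    ∫⁻ p : ℝ × ℝ, ENNReal.ofReal (Real.exp (-η * p.1) * Real.exp (-z * p.2))
        ∂(volume.withDensity fun p => ENNReal.ofReal (h p.1 p.2)) =
      ∫⁻ t in Ioi (0 : ℝ), ENNReal.ofReal
        (Real.exp (-z * t) * ∫ ω, Real.exp (-η * H t.toNNReal ω) ∂P) := by
  have hm : Measurable fun p : ℝ × ℝ => ENNReal.ofReal (h p.1 p.2) := hd.measurable.ennreal_ofReal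
  rw [lintegral_withDensity_eq_lintegral_mul _ hm (by fun_prop), Measure.volume_eq_prod,
    lintegral_prod_symm' _ (hm.mul (by fun_prop)), ← lintegral_indicator measurableSet_Ioi]
  refine lintegral_congr_ae ?_
  -- The slice `t = 0`, where the law is singular, is Lebesgue-null; slices with `t < 0` vanish.
  filter_upwards [Measure.ae_ne volume (0 : ℝ)] with t ht
  simp only [Pi.mul_apply]
  by_cases ht0 : 0 < t
  · rw [indicator_of_mem (mem_Ioi.2 ht0)]
    lift t to ℝ≥0 using ht0.le
    have hmt : Measurable fun x => ENNReal.ofReal (h x t) := hm.comp measurable_prodMk_right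
    have e : ∀ x, ENNReal.ofReal (h x t) *
        ENNReal.ofReal (Real.exp (-η * x) * Real.exp (-z * t)) =
        ENNReal.ofReal (Real.exp (-z * t)) *
          (ENNReal.ofReal (h x t) * ENNReal.ofReal (Real.exp (-η * x))) := fun x => by
      rw [ENNReal.ofReal_mul (Real.exp_pos _).le]
      ring
    simp_rw [e]
    rw [lintegral_const_mul' _ _ ENNReal.ofReal_ne_top, ENNReal.ofReal_mul (Real.exp_pos _).le]
    congr 1
    have hw := lintegral_withDensity_eq_lintegral_mul volume hmt
      (g := fun x => ENNReal.ofReal (Real.exp (-η * x))) (by fun_prop)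
    simp only [Pi.mul_apply] at hw
    rw [← hw, ← hd.density t (NNReal.coe_pos.1 ht0), lintegral_map' (by fun_prop) (hHm t),
      Real.toNNReal_coe, ofReal_integral_eq_lintegral_ofReal]
    · have := hHm t
      refine Integrable.of_bound (C := 1) (by fun_prop) ?_
      filter_upwards [hH0 t] with ω hω
      rw [Real.norm_of_nonneg (Real.exp_pos _).le, Real.exp_le_one_iff]
      nlinarith
    · exact ae_of_all _ fun _ => (Real.exp_pos _).le
  · have ht' : t < 0 := lt_of_le_of_ne (not_lt.1 ht0) ht
    rw [indicator_of_notMem (by simpa using ht'.le)]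
    simp [hd.eq_zero _ t (Or.inr ht')]

/-- The double Laplace transform of a density of the composed process. -/
theorem hasComposedLaplace [IsProbabilityMeasure P] (hd : IsProcessDensity P H h)
    (hHm : ∀ t, AEMeasurable (H t) P)
    (hH0 : ∀ t, ∀ᵐ ω ∂P, 0 ≤ H t ω) (hσ : IsSubordinatorLevyMeasure νσ)
    (hρ : IsSubordinatorLevyMeasure νρ) (h0 : νρ ≠ 0)
    (hlap : ∀ z η : ℝ, 0 < z → 0 < η →
      ∫ t in Ioi (0 : ℝ), Real.exp (-z * t) * (∫ ω, Real.exp (-η * H t.toNNReal ω) ∂P) =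
        laplaceExponent νρ z / (z * (laplaceExponent νσ η + laplaceExponent νρ z))) :
    HasComposedLaplace νσ νρ (volume.withDensity fun p => ENNReal.ofReal (h p.1 p.2)) := by
  have hm : Measurable fun p : ℝ × ℝ => ENNReal.ofReal (h p.1 p.2) := hd.measurable.ennreal_ofReal
  have key : ∀ z η : ℝ, 0 < z → 0 < η →
      ∫⁻ p : ℝ × ℝ, ENNReal.ofReal (Real.exp (-η * p.1) * Real.exp (-z * p.2))
        ∂(volume.withDensity fun p => ENNReal.ofReal (h p.1 p.2)) =
      ENNReal.ofReal
        (laplaceExponent νρ z / (z * (laplaceExponent νσ η + laplaceExponent νρ z))) := by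
    intro z η hz hη
    have hρz := hρ.laplaceExponent_pos h0 hz
    have hση := hσ.laplaceExponent_nonneg hη.le
    rw [hd.lintegral_exp_planar hHm hH0 hη, ← hlap z η hz hη, ofReal_integral_eq_lintegral_ofReal]
    -- The integral of a non-integrable function is `0` by convention, while the value here is
    -- positive since `ρ(z) > 0`; so integrability is automatic.
    · refine Integrable.of_integral_ne_zero ?_
      rw [hlap z η hz hη]
      positivity
    · exact ae_of_all _ fun t =>
        mul_nonneg (Real.exp_pos _).le (integral_nonneg fun ω => (Real.exp_pos _).le)
  have hnn : ∀ z η : ℝ, ∀ p : ℝ × ℝ, 0 ≤ Real.exp (-η * p.1) * Real.exp (-z * p.2) :=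
    fun z η p => by positivity
  refine ⟨?_, fun z η hz hη => ⟨by fun_prop, ?_⟩, fun z η hz hη => ?_⟩
  · rw [ae_withDensity_iff hm]
    refine ae_of_all _ fun p hp => ?_
    by_contra hcon
    refine hp ?_
    rw [hd.eq_zero p.1 p.2, ENNReal.ofReal_zero]
    rw [not_and_or] at hcon
    exact hcon.imp not_le.1 not_le.1
  · rw [hasFiniteIntegral_iff_ofReal (ae_of_all _ (hnn z η)), key z η hz hη]
    exact ENNReal.ofReal_lt_top
  · have hρz := hρ.laplaceExponent_pos h0 hz
    have hση := hσ.laplaceExponent_nonneg hη.le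
    rw [integral_eq_lintegral_of_nonneg_ae (ae_of_all _ (hnn z η)) (by fun_prop), key z η hz hη,
      ENNReal.toReal_ofReal (by positivity)]

theorem integrable_withDensity_iff (hd : IsProcessDensity P H h) {g : ℝ × ℝ → ℝ} :
    Integrable g (volume.withDensity fun p => ENNReal.ofReal (h p.1 p.2)) ↔
      Integrable fun p => h p.1 p.2 * g p := by
  have hm : Measurable fun p : ℝ × ℝ => ENNReal.ofReal (h p.1 p.2) := hd.measurable.ennreal_ofReal
  rw [integrable_withDensity_iff_integrable_smul' hm (ae_of_all _ fun _ => ENNReal.ofReal_lt_top)]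
  simp only [ENNReal.toReal_ofReal (hd.nonneg _ _), smul_eq_mul]

theorem integral_withDensity (hd : IsProcessDensity P H h) (g : ℝ × ℝ → ℝ) :
    ∫ p, g p ∂(volume.withDensity fun p => ENNReal.ofReal (h p.1 p.2)) =
      ∫ p : ℝ × ℝ, h p.1 p.2 * g p := by
  have hm : Measurable fun p : ℝ × ℝ => ENNReal.ofReal (h p.1 p.2) := hd.measurable.ennreal_ofReal
  rw [integral_withDensity_eq_integral_toReal_smul hm (ae_of_all _ fun _ => ENNReal.ofReal_lt_top)]
  simp only [ENNReal.toReal_ofReal (hd.nonneg _ _), smul_eq_mul]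

theorem integrable_withDensity_prod_iff (hd : IsProcessDensity P H h) {ν : Measure ℝ} [SFinite ν]
    {g : (ℝ × ℝ) × ℝ → ℝ} :
    Integrable g ((volume.withDensity fun p => ENNReal.ofReal (h p.1 p.2)).prod ν) ↔
      Integrable (fun q => h q.1.1 q.1.2 * g q) (volume.prod ν) := by
  have hm : Measurable fun p : ℝ × ℝ => ENNReal.ofReal (h p.1 p.2) := hd.measurable.ennreal_ofReal
  have hm' : Measurable fun q : (ℝ × ℝ) × ℝ => ENNReal.ofReal (h q.1.1 q.1.2) :=
    hm.comp measurable_fst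
  rw [prod_withDensity_left hm, integrable_withDensity_iff_integrable_smul' hm'
    (ae_of_all _ fun _ => ENNReal.ofReal_lt_top)]
  simp only [ENNReal.toReal_ofReal (hd.nonneg _ _), smul_eq_mul]

theorem solvesInDistributions [IsProbabilityMeasure P] (hd : IsProcessDensity P H h)
    (hzero : ∀ᵐ ω ∂P, H 0 ω = 0)
    (hM : HasComposedLaplace νσ νρ (volume.withDensity fun p => ENNReal.ofReal (h p.1 p.2)))
    (hσ : IsSubordinatorLevyMeasure νσ) (hρ : IsSubordinatorLevyMeasure νρ) (h0 : νρ ≠ 0) :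
    SolvesInDistributions νσ νρ (P.map (H 0)) h := by
  have := hσ.sigmaFinite
  have := hρ.sigmaFinite
  have hμ₀ : P.map (H 0) = Measure.dirac 0 := by
    rw [Measure.map_congr hzero, Measure.map_const]
    simp
  intro φ hφ hc
  obtain ⟨G, rfl⟩ := exists_eq_cornerIntegral hφ hc
  obtain ⟨C, hG⟩ := G.exists_isQuadrantTest
  have i1 := hM.integrable_prod hρ hG.measurable_sub_snd hG.abs_sub_snd_le
  have i2 := hM.integrable_prod hσ hG.measurable_sub_fst hG.abs_sub_fst_le
  have e1 : ∀ p : ℝ × ℝ, genDerivAdj νρ (fun t => cornerIntegral G p.1 t) p.2 =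
      ∫ y, (cornerIntegral G p.1 p.2 - cornerIntegral G p.1 (p.2 + y)) ∂νρ := fun p => by
    rw [genDerivAdj, hρ.restrict_eq]
  have e2 : ∀ p : ℝ × ℝ, genDerivAdj νσ (fun x => cornerIntegral G x p.2) p.1 =
      ∫ y, (cornerIntegral G p.1 p.2 - cornerIntegral G (p.1 + y) p.2) ∂νσ := fun p => by
    rw [genDerivAdj, hσ.restrict_eq]
  have hw := hM.weakDefect_cornerIntegral hσ hρ h0 G
  rw [weakDefect, integral_prod _ i1, integral_prod _ i2, hd.integral_withDensity,
    hd.integral_withDensity] at hw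
  simp_rw [hμ₀, integral_dirac, e1, e2]
  refine ⟨hd.integrable_withDensity_iff.1 i1.integral_prod_left,
    hd.integrable_withDensity_iff.1 i2.integral_prod_left, hG.integrableOn_initial hρ, ?_⟩
  linarith

/-- This removes the source term from the almost-everywhere equation inside the open quadrant. -/
theorem ae_initial_eq_zero (hd : IsProcessDensity P H h) (hH0 : AEMeasurable (H 0) P)
    (hzero : ∀ᵐ ω ∂P, H 0 ω = 0) :
    ∀ᵐ p : ℝ × ℝ, 0 < p.1 → h p.1 0 = 0 := by
  have hl : (P.map (H 0)).restrict (Ioi 0) = 0 := by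
    rw [Measure.restrict_eq_zero, Measure.map_apply_of_aemeasurable hH0 measurableSet_Ioi]
    refine measure_mono_null (fun ω hω => ?_) (ae_iff.1 hzero)
    exact (mem_Ioi.1 hω).ne'
  have hm : Measurable fun x => ENNReal.ofReal (h x 0) :=
    (hd.measurable.comp measurable_prodMk_right).ennreal_ofReal
  have h1 := hd.initial
  rw [hl, eq_comm, withDensity_eq_zero_iff hm.aemeasurable, Filter.EventuallyEq,
    ae_restrict_iff' measurableSet_Ioi] at h1
  have h2 : ∀ᵐ x : ℝ, 0 < x → h x 0 = 0 := by
    filter_upwards [h1] with x hx hx0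
    exact le_antisymm (ENNReal.ofReal_eq_zero.1 (hx hx0)) (hd.nonneg x 0)
  exact Measure.quasiMeasurePreserving_fst.ae h2

end IsProcessDensity

/-! ### The equation almost everywhere. -/

/-- Integration by parts for difference operators: the adjoint of a mixture of backward
differences is the mixture of the forward differences. -/
theorem integral_mul_integral_sub_shift {E : Type*} [AddCommGroup E] [MeasurableSpace E]
    [MeasurableAdd E] [MeasurableSub E] {μ : Measure E} [SFinite μ] [μ.IsAddRightInvariant]
    {ν : Measure ℝ} [SFinite ν]
    {f g : E → ℝ} {s : ℝ → E} (h1 : Integrable (fun p => g p * f p) μ)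
    (h2 : Integrable (fun q : E × ℝ => g q.1 * (f q.1 - f (q.1 + s q.2))) (μ.prod ν))
    (h3 : Integrable (fun q : E × ℝ => f q.1 * (g q.1 - g (q.1 - s q.2))) (μ.prod ν)) :
    ∫ p, g p * ∫ y, (f p - f (p + s y)) ∂ν ∂μ = ∫ p, f p * ∫ y, (g p - g (p - s y)) ∂ν ∂μ := by
  simp_rw [← integral_const_mul]
  refine (integral_integral_swap (f := fun p y => g p * (f p - f (p + s y))) h2).trans
    (Eq.trans ?_ (integral_integral_swap (f := fun p y => f p * (g p - g (p - s y))) h3).symm)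
  refine integral_congr_ae ?_
  filter_upwards [h2.prod_left_ae] with y hy
  -- The integral over `y` of the unshifted product may diverge, so the difference is split only
  -- after fixing `y`.
  have i1 : Integrable (fun p => g p * f (p + s y)) μ := by
    refine (h1.sub hy).congr (ae_of_all _ fun p => ?_)
    simp only [Pi.sub_apply]
    ring
  have i2 : Integrable (fun p => f p * g (p - s y)) μ := by
    refine (i1.comp_sub_right (s y)).congr (ae_of_all _ fun p => ?_)
    simp only [sub_add_cancel]
    ring
  have i3 : Integrable (fun p => f p * g p) μ := h1.congr (ae_of_all _ fun p => mul_comm _ _)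
  simp_rw [mul_sub]
  rw [integral_sub h1 i1, integral_sub i3 i2]
  have e : ∫ p, g p * f (p + s y) ∂μ = ∫ p, f p * g (p - s y) ∂μ := by
    rw [← integral_sub_right_eq_self (fun p => g p * f (p + s y)) (s y)]
    simp_rw [sub_add_cancel, mul_comm]
  rw [e]
  simp_rw [mul_comm]

section LocalIntegrability

variable {E : Type*} [MeasurableSpace E] {μ : Measure E} {ν : Measure ℝ} [SFinite ν]
  {g : E × ℝ → ℝ}

theorem integrableOn_integral_prod {K : Set E} (hgm : Measurable g)
    (hg : ∫⁻ p in K, ∫⁻ y, ‖g (p, y)‖ₑ ∂ν ∂μ < ∞) :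
    IntegrableOn (fun p => ∫ y, g (p, y) ∂ν) K μ := by
  refine Integrable.integral_prod_left (f := g) (μ := μ.restrict K) ⟨by fun_prop, ?_⟩
  rw [HasFiniteIntegral, lintegral_prod _ (by fun_prop)]
  exact hg

theorem HasCompactSupport.integrable_mul_prod [TopologicalSpace E] [BorelSpace E]
    [SFinite μ] {f : E → ℝ} (hc : HasCompactSupport f)
    (hf : Continuous f) (hgm : Measurable g)
    (hg : ∫⁻ p in tsupport f, ∫⁻ y, ‖g (p, y)‖ₑ ∂ν ∂μ < ∞) :
    Integrable (fun q : E × ℝ => f q.1 * g q) (μ.prod ν) := by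
  obtain ⟨C, hC⟩ := hf.bounded_above_of_compact_support hc
  have hi : Integrable g ((μ.restrict (tsupport f)).prod ν) := by
    refine ⟨by fun_prop, ?_⟩
    rw [HasFiniteIntegral, lintegral_prod _ (by fun_prop)]
    exact hg
  have hK : MeasurableSet (tsupport f) := (isClosed_tsupport f).measurableSet
  have hr : (μ.restrict (tsupport f)).prod ν = (μ.prod ν).restrict (tsupport f ×ˢ univ) := by
    rw [← Measure.prod_restrict, Measure.restrict_univ]
  rw [hr] at hi
  have hm : AEStronglyMeasurable (fun q : E × ℝ => f q.1)
      ((μ.prod ν).restrict (tsupport f ×ˢ univ)) :=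
    (hf.measurable.comp measurable_fst).aestronglyMeasurable
  have := hi.bdd_mul hm (ae_of_all _ fun q => hC q.1)
  refine (IntegrableOn.integrable_of_forall_notMem_eq_zero this fun q hq => ?_)
  rw [image_eq_zero_of_notMem_tsupport fun h => hq ⟨h, mem_univ _⟩, zero_mul]

end LocalIntegrability

namespace IsProcessDensity

variable {Ω : Type*} [MeasurableSpace Ω] {P : Measure Ω} {H : ℝ≥0 → Ω → ℝ} {h : ℝ → ℝ → ℝ}
  {νσ νρ : Measure ℝ}

/-- The governing equation at almost every point at which the derivatives converge absolutely. -/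
theorem ae_genDeriv_eq (hd : IsProcessDensity P H h) (hH0 : AEMeasurable (H 0) P)
    (hzero : ∀ᵐ ω ∂P, H 0 ω = 0)
    (hM : HasComposedLaplace νσ νρ (volume.withDensity fun p => ENNReal.ofReal (h p.1 p.2)))
    (hσ : IsSubordinatorLevyMeasure νσ) (hρ : IsSubordinatorLevyMeasure νρ) (h0 : νρ ≠ 0)
    {U : Set (ℝ × ℝ)} (hU : IsOpen U) (hUpos : U ⊆ Ioi 0 ×ˢ Ioi 0)
    (hK : ∀ K : Set (ℝ × ℝ), IsCompact K → K ⊆ U →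
      (∫⁻ p in K, ∫⁻ y in Ioi (0 : ℝ), ‖h p.1 p.2 - h p.1 (p.2 - y)‖ₑ ∂νρ) < ∞ ∧
      (∫⁻ p in K, ∫⁻ y in Ioi (0 : ℝ), ‖h p.1 p.2 - h (p.1 - y) p.2‖ₑ ∂νσ) < ∞) :
    ∀ᵐ p : ℝ × ℝ ∂(volume.restrict U),
      genDeriv νρ (fun t => h p.1 t) p.2 =
        -genDeriv νσ (fun x => h x p.2) p.1 + h p.1 0 * levyTail νρ p.2 := by
  have := hσ.sigmaFinite
  have := hρ.sigmaFinite
  simp_rw [hσ.restrict_eq, hρ.restrict_eq] at hK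
  have d1 : ∀ p : ℝ × ℝ, genDeriv νρ (fun t => h p.1 t) p.2 =
      ∫ y, (h p.1 p.2 - h p.1 (p.2 - y)) ∂νρ := fun p => by rw [genDeriv, hρ.restrict_eq]
  have d2 : ∀ p : ℝ × ℝ, genDeriv νσ (fun x => h x p.2) p.1 =
      ∫ y, (h p.1 p.2 - h (p.1 - y) p.2) ∂νσ := fun p => by rw [genDeriv, hσ.restrict_eq]
  have m0 : Measurable fun q : (ℝ × ℝ) × ℝ => h q.1.1 q.1.2 := hd.measurable.comp measurable_fst
  have m1 : Measurable fun q : (ℝ × ℝ) × ℝ => h q.1.1 q.1.2 - h q.1.1 (q.1.2 - q.2) :=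
    m0.sub (hd.measurable.comp
      (by fun_prop : Measurable fun q : (ℝ × ℝ) × ℝ => (q.1.1, q.1.2 - q.2)))
  have m2 : Measurable fun q : (ℝ × ℝ) × ℝ => h q.1.1 q.1.2 - h (q.1.1 - q.2) q.1.2 :=
    m0.sub (hd.measurable.comp
      (by fun_prop : Measurable fun q : (ℝ × ℝ) × ℝ => (q.1.1 - q.2, q.1.2)))
  -- Needed by the fundamental lemma; this is where absolute convergence over compact sets enters.
  have hloc : LocallyIntegrableOn (fun p : ℝ × ℝ => genDeriv νρ (fun t => h p.1 t) p.2 +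
      genDeriv νσ (fun x => h x p.2) p.1) U := by
    rw [locallyIntegrableOn_iff hU.isLocallyClosed]
    intro K hKU hKc
    simp_rw [d1, d2]
    exact (integrableOn_integral_prod m1 (hK K hKc hKU).1).add
      (integrableOn_integral_prod m2 (hK K hKc hKU).2)
  have hweak : ∀ ψ : ℝ × ℝ → ℝ, ContDiff ℝ (⊤ : ℕ∞) ψ → HasCompactSupport ψ → tsupport ψ ⊆ U →
      ∫ p : ℝ × ℝ, ψ p • (genDeriv νρ (fun t => h p.1 t) p.2 +
        genDeriv νσ (fun x => h x p.2) p.1) = 0 := by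
    intro ψ hψ hψc hψU
    obtain ⟨G, hG⟩ := exists_eq_cornerIntegral (φ := Function.curry ψ)
      (by rwa [Function.uncurry_curry]) (by rwa [Function.uncurry_curry])
    have hG' : ∀ x t, cornerIntegral G x t = ψ (x, t) := fun x t => by rw [← hG]; rfl
    obtain ⟨C, hC⟩ := G.exists_isQuadrantTest
    have i1 := hd.integrable_withDensity_prod_iff.1
      (hM.integrable_prod hρ hC.measurable_sub_snd hC.abs_sub_snd_le)
    have i2 := hd.integrable_withDensity_prod_iff.1
      (hM.integrable_prod hσ hC.measurable_sub_fst hC.abs_sub_fst_le)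
    have i0 : Integrable fun p : ℝ × ℝ => h p.1 p.2 * ψ p := by
      refine hd.integrable_withDensity_iff.1
        (((hM.integrable 1 1 one_pos one_pos).const_mul C).mono'
        hψ.continuous.aestronglyMeasurable ?_)
      filter_upwards [hM.ae_quadrant] with p hp
      simp_rw [neg_one_mul]
      have := hC.abs_le p.1 p.2 hp.1 hp.2
      rwa [hG'] at this
    simp_rw [hG'] at i1 i2
    obtain ⟨k1, k2⟩ := hK _ hψc.isCompact hψU
    have j1 := hψc.integrable_mul_prod hψ.continuous m1 k1
    have j2 := hψc.integrable_mul_prod hψ.continuous m2 k2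
    have e1 : ∫ p : ℝ × ℝ, h p.1 p.2 * ∫ y, (ψ (p.1, p.2) - ψ (p.1, p.2 + y)) ∂νρ =
        ∫ p : ℝ × ℝ, ψ p * ∫ y, (h p.1 p.2 - h p.1 (p.2 - y)) ∂νρ := by
      have := integral_mul_integral_sub_shift (μ := (volume : Measure (ℝ × ℝ))) (ν := νρ) (f := ψ)
        (g := fun p => h p.1 p.2) (s := fun y => (0, y)) i0
        (by simpa [Prod.add_def] using i1) (by simpa [Prod.sub_def] using j1)
      simpa [Prod.add_def, Prod.sub_def] using this
    have e2 : ∫ p : ℝ × ℝ, h p.1 p.2 * ∫ y, (ψ (p.1, p.2) - ψ (p.1 + y, p.2)) ∂νσ =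
        ∫ p : ℝ × ℝ, ψ p * ∫ y, (h p.1 p.2 - h (p.1 - y) p.2) ∂νσ := by
      have := integral_mul_integral_sub_shift (μ := (volume : Measure (ℝ × ℝ))) (ν := νσ) (f := ψ)
        (g := fun p => h p.1 p.2) (s := fun y => (y, 0)) i0
        (by simpa [Prod.add_def] using i2) (by simpa [Prod.sub_def] using j2)
      simpa [Prod.add_def, Prod.sub_def] using this
    -- The source is carried by the line `x = 0`, which `U` does not meet, so its contribution to
    -- the weak equation vanishes.
    have hbdry : ∀ t, ψ (0, t) = 0 := fun t => by
      refine image_eq_zero_of_notMem_tsupport fun hmem => ?_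
      exact lt_irrefl (0 : ℝ) (hUpos (hψU hmem)).1
    have hw := hM.weakDefect_cornerIntegral hσ hρ h0 G
    rw [weakDefect, integral_prod _ (hM.integrable_prod hρ hC.measurable_sub_snd hC.abs_sub_snd_le),
      integral_prod _ (hM.integrable_prod hσ hC.measurable_sub_fst hC.abs_sub_fst_le),
      hd.integral_withDensity, hd.integral_withDensity] at hw
    simp only [hG', hbdry, zero_mul, integral_zero, sub_zero] at hw
    rw [e1, e2] at hw
    have l1 : Integrable fun p : ℝ × ℝ => ψ p * ∫ y, (h p.1 p.2 - h p.1 (p.2 - y)) ∂νρ := by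
      simpa only [integral_const_mul] using j1.integral_prod_left
    have l2 : Integrable fun p : ℝ × ℝ => ψ p * ∫ y, (h p.1 p.2 - h (p.1 - y) p.2) ∂νσ := by
      simpa only [integral_const_mul] using j2.integral_prod_left
    simp_rw [d1, d2, smul_eq_mul, mul_add]
    rw [integral_add l1 l2, hw]
  have hae := hU.ae_eq_zero_of_integral_contDiff_smul_eq_zero hloc hweak
  rw [ae_restrict_iff' hU.measurableSet]
  filter_upwards [hae, hd.ae_initial_eq_zero hH0 hzero] with p h1 h2 hp
  have h3 := h1 hp
  rw [h2 (hUpos hp).1, zero_mul, add_zero]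
  linarith

end IsProcessDensity

theorem mainTheorem8 {Ω : Type*} [MeasurableSpace Ω] (P : Measure Ω) [IsProbabilityMeasure P]
    (νσ νρ : Measure ℝ)
    (hσ : IsSubordinatorLevyMeasure νσ) (hρ : IsSubordinatorLevyMeasure νρ) (hρ0 : νρ ≠ 0)
    (S T : ℝ≥0 → Ω → ℝ)
    (hS : IsSubordinator P S νσ) (hT : IsSubordinator P T νρ)
    (hindep : IndepFun (fun ω t => S t ω) (fun ω t => inverseProcess T t ω) P) :
    -- the double Laplace transform
    (∀ z η : ℝ, 0 < z → 0 < η →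
      ∫ t in Ioi (0 : ℝ), Real.exp (-z * t) *
          (∫ ω, Real.exp (-η * composedProcess S T t.toNNReal ω) ∂P) =
        laplaceExponent νρ z / (z * (laplaceExponent νσ η + laplaceExponent νρ z))) ∧
    -- the governing equation
    (νρ univ = ∞ →
      -- the initial distribution `h(x, 0)` is the Dirac delta
      (∀ᵐ ω ∂P, composedProcess S T 0 ω = 0) ∧
      -- there is a density
      ((∀ t : ℝ≥0, 0 < t → P.map (S t) ≪ volume) →
        ∃ h : ℝ → ℝ → ℝ, IsProcessDensity P (composedProcess S T) h) ∧
      ∀ h : ℝ → ℝ → ℝ, IsProcessDensity P (composedProcess S T) h →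
        -- the equation holds in the sense of distributions
        SolvesInDistributions νσ νρ (P.map (composedProcess S T 0)) h ∧
        -- the equation holds almost everywhere where the derivatives converge absolutely
        ∀ U : Set (ℝ × ℝ), IsOpen U → U ⊆ Ioi 0 ×ˢ Ioi 0 →
          (∀ K : Set (ℝ × ℝ), IsCompact K → K ⊆ U →
            (∫⁻ p in K, ∫⁻ y in Ioi (0 : ℝ), ‖h p.1 p.2 - h p.1 (p.2 - y)‖ₑ ∂νρ) < ∞ ∧
            (∫⁻ p in K, ∫⁻ y in Ioi (0 : ℝ), ‖h p.1 p.2 - h (p.1 - y) p.2‖ₑ ∂νσ) < ∞) →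
          ∀ᵐ p : ℝ × ℝ ∂(volume.restrict U),
            genDeriv νρ (fun t => h p.1 t) p.2 =
              -genDeriv νσ (fun x => h x p.2) p.1 + h p.1 0 * levyTail νρ p.2) := by
  have hHm := hS.aemeasurable_composedProcess hT hρ hρ0
  have hlap : ∀ z η : ℝ, 0 < z → 0 < η →
      ∫ t in Ioi (0 : ℝ), Real.exp (-z * t) *
          (∫ ω, Real.exp (-η * composedProcess S T t.toNNReal ω) ∂P) =
        laplaceExponent νρ z / (z * (laplaceExponent νσ η + laplaceExponent νρ z)) :=
    fun z η hz hη => hS.laplace_composedProcess hT hσ hρ hρ0 hindep hz hη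
  refine ⟨hlap, fun hinf => ?_⟩
  have hzero := hS.ae_composedProcess_zero hT hρ hinf
  refine ⟨hzero, hS.exists_isProcessDensity hT hρ hρ0 hinf hindep, fun h hd => ?_⟩
  have hM := hd.hasComposedLaplace hHm (hS.ae_composedProcess_nonneg T) hσ hρ hρ0 hlap
  exact ⟨hd.solvesInDistributions hzero hM hσ hρ hρ0,
    fun U hU hUpos hK => hd.ae_genDeriv_eq (hHm 0) hzero hM hσ hρ hρ0 hU hUpos hK⟩
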